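/- Work in the PL category, with $S^3$ a PL 3-sphere (the boundary of the cube $[-1,1]^4$). An embedded graph is a finite oriented graph $G$ PL-embedded in $S^3$. A local replacement at a vertex $v$ connects two of the edge ends at $v$ and leaves all other edge ends at $v$ free (at a vertex with fewer than two edge ends nothing is connected). After choosing a local replacement at every vertex, delete all arcs with free ends and keep the link formed by the closed curves. Let $T(G)$ (the Kauffman family of $G$) be the set of all nonempty links obtained in this way. A PL cobordism $\Sigma\colon G\to G'$ is an oriented compact polyhedron of dimension at most $2$ (the underlying set of a finite simplicial complex of dimension at most $2$, each of whose 2-simplices is oriented, considered up to subdivision) PL-embedded in $S^3\times[0,1]$, with $\Sigma\cap(S^3\times\{0\})=G$, $\Sigma\cap(S^3\times\{1\})=G'$ and boundary $G\cup -G'$, in the sense that near $S^3\times\{0\}$ and near $S^3\times\{1\}$ it coincides, as an oriented polyhedron, with $G\times[0,1]$ and $G'\times[0,1]$ respectively; here $e\times[0,1]$ carries the product orientation for every oriented edge $e$. Two cobordisms $G\to G'$ are isotopic if a PL ambient isotopy of $S^3\times[0,1]$ fixing $S^3\times\{0,1\}$ pointwise carries one to the other, preserving orientations. For $\Sigma\colon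 G\to G'$ and $\Sigma'\colon G'\to G''$ the glued complex $\Sigma\cup_{G'}\Sigma'$ is the union of $\Sigma$ rescaled to $S^3\times[0,\tfrac12]$ and $\Sigma'$ rescaled to $S^3\times[\tfrac12,1]$. **Lemma.** The cylinder $G\times[0,1]$ is a PL cobordism from $G$ to $G$, and gluing two PL cobordisms $G\to G'$ and $G'\to G''$ gives a PL cobordism $G\to G''$. There is a pre-additive category $\mathcal{G_K}$ (all Hom-sets are abelian groups and composition is bilinear) such that - its objects are the embedded graphs $G$ with $T(G)\neq\emptyset$; - $\mathrm{Hom}(G,G')$ is the group of formal finite integer linear combinations $\sum_n a_n[\Sigma_n]$ of isotopy classes of PL cobordisms from $G$ to $G'$, with coefficientwise addition; - the identity of $G$ is the class $[G\times[0,1]]$; - the composite of the classes $[\Sigma]\in\mathrm{Hom}(G,G')$ and $[\Sigma']\in\mathrm{Hom}(G',G'')$ is $[\Sigma\cup_{G'}\Sigma']$. -/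

import Mathlib

/-- The piecewise linear ambient space of the 3-sphere: coordinates with the sup norm. -/
abbrev R4 : Type := Fin 4 → ℝ

/-- `R4 × ℝ`; the second coordinate is the height (the cobordism direction). -/
abbrev R5 : Type := R4 × ℝ

/-- The PL 3-sphere, as the boundary of the cube `[-1,1]⁴` (the sup-norm unit sphere of `ℝ⁴`). -/
def S3 : Set R4 := Metric.sphere (0 : R4) 1

/-- `S³ × [0,1]`. -/
def slab : Set R5 := S3 ×ˢ Set.Icc (0 : ℝ) 1

/-- Compact polyhedra: finite unions of convex hulls of finite sets, equivalently the underlying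
sets of finite geometric simplicial complexes. -/
def IsPolyhedron {E : Type*} [AddCommGroup E] [Module ℝ E] (X : Set E) : Prop :=
  ∃ P : Finset (Finset E), X = ⋃ s ∈ P, convexHull ℝ (s : Set E)

/-! ### Embedded graphs and their Kauffman families of links -/

/-- An oriented graph PL-embedded in `S³`, presented as a 1-dimensional simplicial complex:
`(a, b) ∈ edges` is the straight edge oriented from `a` to `b`. A polygonal edge (in particular a
loop or one of several parallel edges) is subdivided by vertices of degree two. -/
structure SpatialGraph where
  verts : Finset R4
  edges : Finset (R4 × R4)
  verts_mem : ∀ v ∈ verts, v ∈ S3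
  ends_mem : ∀ e ∈ edges, e.1 ∈ verts ∧ e.2 ∈ verts
  ends_ne : ∀ e ∈ edges, e.1 ≠ e.2
  edge_subset : ∀ e ∈ edges, segment ℝ e.1 e.2 ⊆ S3
  vert_of_mem_edge : ∀ v ∈ verts, ∀ e ∈ edges, v ∈ segment ℝ e.1 e.2 → v = e.1 ∨ v = e.2
  edge_inter : ∀ e ∈ edges, ∀ f ∈ edges, e ≠ f →
    segment ℝ e.1 e.2 ∩ segment ℝ f.1 f.2 ⊆ ({e.1, e.2} ∩ {f.1, f.2} : Set R4)

namespace SpatialGraph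

/-- The edges ending at `v` (in either direction). -/
def incident (G : SpatialGraph) (v : R4) : Set (R4 × R4) :=
  {e | e ∈ G.edges ∧ (v = e.1 ∨ v = e.2)}

/-- A choice of a local replacement at every vertex. `c v` is the set of edges that the replacement
at `v` connects: two of the edges at `v` when there are at least two, and none otherwise. All other
edges at `v` are left with a free end there. -/
def IsReplacement (G : SpatialGraph) (c : R4 → Set (R4 × R4)) : Prop :=
  ∀ v ∈ G.verts, c v ⊆ G.incident v ∧
    (2 ≤ (G.incident v).ncard → (c v).ncard = 2) ∧ ((G.incident v).ncard < 2 → c v = ∅)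

/-- `e` and `f` are connected to each other at some vertex by the replacement `c`. -/
def Joined (G : SpatialGraph) (c : R4 → Set (R4 × R4)) (e f : R4 × R4) : Prop :=
  ∃ v ∈ G.verts, e ∈ c v ∧ f ∈ c v

/-- The edges on the closed curves formed by the replacement `c`: those from which no free end can
be reached. The other edges form arcs, which are eliminated. -/
def closedEdges (G : SpatialGraph) (c : R4 → Set (R4 × R4)) : Set (R4 × R4) :=
  {e | e ∈ G.edges ∧ ∀ f, Relation.ReflTransGen (G.Joined c) e f → f ∈ c f.1 ∧ f ∈ c f.2}

/-- The link formed by the closed curves of the replacement `c`. -/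
def link (G : SpatialGraph) (c : R4 → Set (R4 × R4)) : Set R4 :=
  ⋃ e ∈ G.closedEdges c, segment ℝ e.1 e.2

/-- Kauffman's family `T(G)` of all (nonempty) links obtained by local replacements. -/
def linkFamily (G : SpatialGraph) : Set (Set R4) :=
  {L | L.Nonempty ∧ ∃ c, G.IsReplacement c ∧ L = G.link c}

end SpatialGraph

/-- Objects: the embedded graphs that have a family of links. -/
structure KauffmanGraph extends SpatialGraph where
  has_links : toSpatialGraph.linkFamily.Nonempty

/-! ### Oriented 2-complexes -/

/-- The ordered triangle `ρ` lies in the ordered triangle `σ` and has the same orientation: its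
barycentric coordinates with respect to `σ` are nonnegative and have positive determinant. -/
def IsPosSub (ρ σ : Fin 3 → R5) : Prop :=
  ∃ M : Matrix (Fin 3) (Fin 3) ℝ, (∀ i j, 0 ≤ M i j) ∧ (∀ i, ∑ j, M i j = 1) ∧ 0 < M.det ∧
    ∀ i, ρ i = ∑ j, M i j • σ j

/-- The triangle `ρ` with the opposite orientation. -/
def flipTriangle (ρ : Fin 3 → R5) : Fin 3 → R5 := ρ ∘ Equiv.swap 0 1

/-- Data of an oriented polyhedron of dimension at most two: ordered triangles, which carry the
orientation, and segments (possibly degenerate to points) for the lower-dimensional part. The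
conditions on the data are in `TwoComplex.IsOriented`. -/
structure TwoComplex where
  cells : Set (Fin 3 → R5)
  wires : Set (R5 × R5)

namespace TwoComplex

/-- The underlying set. -/
def carrier (K : TwoComplex) : Set R5 :=
  (⋃ σ ∈ K.cells, convexHull ℝ (Set.range σ)) ∪ ⋃ w ∈ K.wires, segment ℝ w.1 w.2

/-- Finitely many nondegenerate triangles and segments, such that triangles that overlap in
dimension two induce the same orientation on the overlap. -/
structure IsOriented (K : TwoComplex) : Prop where
  cells_finite : K.cells.Finite
  wires_finite : K.wires.Finite
  nondegenerate : ∀ σ ∈ K.cells, AffineIndependent ℝ σ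
  consistent : ∀ σ ∈ K.cells, ∀ τ ∈ K.cells, ∀ ρ, IsPosSub ρ σ → ¬ IsPosSub (flipTriangle ρ) τ

/-- `τ` is a positively oriented triangle in the oriented polyhedron `K`: it lies in `K` and is
nowhere negatively oriented. This does not change when the triangles of `K` are subdivided. -/
def Positive (K : TwoComplex) (τ : Fin 3 → R5) : Prop :=
  AffineIndependent ℝ τ ∧ convexHull ℝ (Set.range τ) ⊆ K.carrier ∧
    ∀ σ ∈ K.cells, ∀ ρ, IsPosSub ρ τ → ¬ IsPosSub (flipTriangle ρ) σ

/-- `K` and `L` coincide, as oriented polyhedra, on `S`. -/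
def AgreeOn (K L : TwoComplex) (S : Set R5) : Prop :=
  (∀ p ∈ S, p ∈ K.carrier ↔ p ∈ L.carrier) ∧
    ∀ τ : Fin 3 → R5, (∀ i, τ i ∈ S) → (K.Positive τ ↔ L.Positive τ)

/-- The cylinder `G × [0,1]`, each rectangle `e × [0,1]` being oriented by the direction of `e`
followed by the upward direction, so that its oriented boundary is `e` at the bottom and `-e` at
the top. -/
def cylinder (G : SpatialGraph) : TwoComplex where
  cells := {σ | ∃ e ∈ G.edges,
    σ = ![(e.1, 0), (e.2, 0), (e.1, 1)] ∨ σ = ![(e.2, 0), (e.2, 1), (e.1, 1)]}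
  wires := {w | ∃ v ∈ G.verts, w = ((v, 0), (v, 1))}

/-- `S³ × [0,1] → S³ × [0,1/2]`. -/
noncomputable def lowerHalf (p : R5) : R5 := (p.1, p.2 / 2)

/-- `S³ × [0,1] → S³ × [1/2,1]`. -/
noncomputable def upperHalf (p : R5) : R5 := (p.1, (p.2 + 1) / 2)

/-- Gluing: `A` is compressed into `S³ × [0,1/2]` and `B` into `S³ × [1/2,1]`. -/
noncomputable def glue (A B : TwoComplex) : TwoComplex where
  cells := (fun σ => lowerHalf ∘ σ) '' A.cells ∪ (fun σ => upperHalf ∘ σ) '' B.cells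
  wires := Prod.map lowerHalf lowerHalf '' A.wires ∪ Prod.map upperHalf upperHalf '' B.wires

/-- `K` is a PL cobordism from `G` to `H`: an oriented 2-complex PL-embedded in `S³ × [0,1]`, with
`∂K = G ∪ -H`, where `G = K ∩ (S³ × 0)` and `H = K ∩ (S³ × 1)`. As usual in cobordism categories,
`K` is a product near the two ends. -/
structure IsCobordism (G H : SpatialGraph) (K : TwoComplex) : Prop where
  oriented : K.IsOriented
  subset_slab : K.carrier ⊆ slab
  bottom : ∃ ε > 0, K.AgreeOn (cylinder G) {p | p.2 ≤ ε}
  top : ∃ ε > 0, K.AgreeOn (cylinder H) {p | 1 - ε ≤ p.2}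

end TwoComplex

/-! ### Isotopy classes of cobordisms -/

/-- PL ambient isotopies `(Φ s)`, `0 ≤ s ≤ 1`, of `S³ × [0,1]` relative to the two ends. A map
between compact polyhedra is PL exactly when its graph is a compact polyhedron. -/
structure IsPLIsotopy (Φ : ℝ → R5 → R5) : Prop where
  pl : IsPolyhedron {q : (ℝ × R5) × R5 |
    q.1.1 ∈ Set.Icc (0 : ℝ) 1 ∧ q.1.2 ∈ slab ∧ q.2 = Φ q.1.1 q.1.2}
  bij : ∀ s ∈ Set.Icc (0 : ℝ) 1, Set.BijOn (Φ s) slab slab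
  start : ∀ p ∈ slab, Φ 0 p = p
  rel_ends : ∀ s ∈ Set.Icc (0 : ℝ) 1, ∀ p ∈ slab, p.2 = 0 ∨ p.2 = 1 → Φ s p = p

/-- The PL cobordisms from `G` to `H`. -/
def Cobordism (G H : KauffmanGraph) : Type :=
  {K : TwoComplex // K.IsCobordism G.toSpatialGraph H.toSpatialGraph}

/-- `A` and `B` are isotopic: the end map `h` of a PL ambient isotopy relative to the ends carries
`A` onto `B` and preserves orientations, tested on the triangles on which `h` is affine. -/
def Isotopic {G H : KauffmanGraph} (A B : Cobordism G H) : Prop :=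
  ∃ Φ : ℝ → R5 → R5, IsPLIsotopy Φ ∧ Φ 1 '' A.1.carrier = B.1.carrier ∧
    ∀ τ : Fin 3 → R5, convexHull ℝ (Set.range τ) ⊆ slab →
      (∃ f : R5 →ᵃ[ℝ] R5, Set.EqOn (Φ 1) f (convexHull ℝ (Set.range τ))) →
      (A.1.Positive τ ↔ B.1.Positive (Φ 1 ∘ τ))

/-- Isotopy classes of PL cobordisms (classes of the equivalence relation generated by
`Isotopic`). -/
def CobordismClass (G H : KauffmanGraph) : Type := Quot (Isotopic (G := G) (H := H))

/-- The formal integer linear combinations of isotopy classes of PL cobordisms. -/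
abbrev CobordismGroup (G H : KauffmanGraph) : Type := CobordismClass G H →₀ ℤ

/-- The basis element given by a complex `K` that is a cobordism from `G` to `H`. -/
noncomputable def cobordismClass {G H : KauffmanGraph} (K : TwoComplex)
    (hK : K.IsCobordism G.toSpatialGraph H.toSpatialGraph) : CobordismGroup G H :=
  Finsupp.single (Quot.mk _ ⟨K, hK⟩) 1

/-! ### Ordered triangles -/

/-! Once isotopy classes of cobordisms are known to form an ordinary category, the preadditive
category is the free ℤ-linear category on it: Hom-groups are finitely supported functions on the
classes, and composition is extended bilinearly. The work is therefore to show that gluing gives a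
cobordism, respects isotopy, and is unital and associative up to isotopy.

Orientations are handled through negativity. A nondegenerate triangle inside the carrier is positive
exactly when it has no negatively oriented subtriangle (`positive_iff`). Negativity of a small
triangle passes to its subtriangles, and every triangle has a subtriangle on one side of any given
height (`IsPosSub.exists_height`), so comparisons of orientation can be made on each side of a
horizontal level separately. Hence the `join` lemmas for `Match` (comparison by a vertical affine
map) and `Carries` (comparison by an arbitrary map).

Three facts feed these comparisons. The part of a cylinder between two heights is carried to another
such part by any increasing affine change of height, whatever the triangulation (`match_cylinder`).
Each cobordism is a cylinder near its ends (`exists_collar`). The two pieces of a glued complex are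
rescaled copies of the originals (`match_glue_lower`, `match_glue_upper`); no triangle interferes at
the middle level, because the ends of a cobordism are one-dimensional.

Isotopies of the factors fix the ends and so can be stacked, which makes composition well defined.
The unit and associativity laws come from PL isotopies that change only the height. For the unit
laws the collar is needed: the inserted cylinder is squeezed, together with the compressed collar,
back into the collar. These isotopies are maxima or minima of functions affine in time and height
jointly, so that their graphs are polyhedra; straight-line interpolation to a nonlinear
reparametrization would involve products of time and height. -/

theorem AffineMap.map_stochastic_sum {E F : Type*} [AddCommGroup E] [Module ℝ E] [AddCommGroup F]
    [Module ℝ F] (f : E →ᵃ[ℝ] F) {w : Fin 3 → ℝ} (hw : ∑ j, w j = 1) (p : Fin 3 → E) :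
    f (∑ j, w j • p j) = ∑ j, w j • f (p j) := by
  have h : ∀ x, f x = f.linear x + f 0 := fun x => congrFun f.decomp x
  rw [h, map_sum, Finset.sum_congr rfl fun j _ => congrArg (w j • ·) (h (p j))]
  simp only [map_smul, smul_add, Finset.sum_add_distrib]
  rw [← Finset.sum_smul, hw, one_smul]

theorem mem_convexHull_triangle {E : Type*} [AddCommGroup E] [Module ℝ E] {τ : Fin 3 → E} {x : E} :
    x ∈ convexHull ℝ (Set.range τ) ↔
      ∃ w : Fin 3 → ℝ, (∀ j, 0 ≤ w j) ∧ ∑ j, w j = 1 ∧ x = ∑ j, w j • τ j := by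
  constructor
  · intro h
    rw [convexHull_range_eq_exists_affineCombination] at h
    obtain ⟨s, w, h0, h1, rfl⟩ := h
    refine ⟨fun j => if j ∈ s then w j else 0, ?_, ?_, ?_⟩
    · intro j
      by_cases hj : j ∈ s <;> simp [hj, h0]
    · simpa [Finset.sum_ite_mem] using h1
    · rw [Finset.affineCombination_eq_linear_combination s τ w h1]
      simp [ite_smul, Finset.sum_ite_mem]
  · rintro ⟨w, h0, h1, rfl⟩
    exact (convex_convexHull ℝ _).sum_mem (fun j _ => h0 j) h1
      fun j _ => subset_convexHull ℝ _ ⟨j, rfl⟩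

theorem affineIndependent_triangle_iff {E : Type*} [AddCommGroup E] [Module ℝ E] {τ : Fin 3 → E} :
    AffineIndependent ℝ τ ↔
      ∀ w : Fin 3 → ℝ, ∑ j, w j = 0 → ∑ j, w j • τ j = 0 → ∀ j, w j = 0 := by
  rw [affineIndependent_iff]
  constructor
  · intro h w h0 h1 j
    exact h Finset.univ w h0 h1 j (Finset.mem_univ j)
  · intro h s w h0 h1 j hj
    have := h (fun j => if j ∈ s then w j else 0) (by simpa [Finset.sum_ite_mem] using h0)
      (by simpa [ite_smul, Finset.sum_ite_mem] using h1) j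
    simpa [hj] using this

namespace IsPosSub

theorem refl (σ : Fin 3 → R5) : IsPosSub σ σ :=
  ⟨1, fun i j => by by_cases h : i = j <;> simp [Matrix.one_apply, h], fun i => by
    simp [Matrix.one_apply], by simp, fun i => by simp [Matrix.one_apply]⟩

theorem trans {ρ σ τ : Fin 3 → R5} (h₁ : IsPosSub ρ σ) (h₂ : IsPosSub σ τ) : IsPosSub ρ τ := by
  obtain ⟨M, M0, M1, Md, hM⟩ := h₁
  obtain ⟨N, N0, N1, Nd, hN⟩ := h₂
  refine ⟨M * N, fun i j => by
      rw [Matrix.mul_apply]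
      exact Finset.sum_nonneg fun k _ => mul_nonneg (M0 i k) (N0 k j), fun i => ?_,
    by rw [Matrix.det_mul]; exact mul_pos Md Nd, fun i => ?_⟩
  · simp only [Matrix.mul_apply]
    rw [Finset.sum_comm]
    simp [← Finset.mul_sum, N1, M1]
  · rw [hM]
    simp only [Matrix.mul_apply, hN, Finset.smul_sum, Finset.sum_smul, mul_smul]
    rw [Finset.sum_comm]

theorem flip {ρ σ : Fin 3 → R5} (h : IsPosSub ρ σ) : IsPosSub (flipTriangle ρ) (flipTriangle σ) := by
  obtain ⟨M, M0, M1, Md, hM⟩ := h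
  refine ⟨M.submatrix (Equiv.swap 0 1) (Equiv.swap 0 1), fun i j => M0 _ _, fun i => ?_,
    by rwa [Matrix.det_submatrix_equiv_self], fun i => ?_⟩
  · simp only [Matrix.submatrix_apply]
    rw [Equiv.sum_comp (Equiv.swap (0 : Fin 3) 1) (fun j => M _ j), M1]
  · simp only [flipTriangle, Function.comp, Matrix.submatrix_apply]
    rw [Equiv.sum_comp (Equiv.swap (0 : Fin 3) 1) (fun j => M _ j • σ j), hM]

theorem vertex_mem {ρ σ : Fin 3 → R5} (h : IsPosSub ρ σ) (i : Fin 3) :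
    ρ i ∈ convexHull ℝ (Set.range σ) := by
  obtain ⟨M, M0, M1, -, hM⟩ := h
  exact mem_convexHull_triangle.2 ⟨M i, M0 i, M1 i, hM i⟩

theorem convexHull_subset {ρ σ : Fin 3 → R5} (h : IsPosSub ρ σ) :
    convexHull ℝ (Set.range ρ) ⊆ convexHull ℝ (Set.range σ) :=
  convexHull_min (Set.range_subset_iff.2 h.vertex_mem) (convex_convexHull ℝ _)

/-- A convex set that contains the vertices of a triangle contains those of its subtriangles. -/
theorem mem_of_convex {ρ σ : Fin 3 → R5} (h : IsPosSub ρ σ) {S : Set R5} (hS : Convex ℝ S)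
    (hσ : ∀ i, σ i ∈ S) (i : Fin 3) : ρ i ∈ S :=
  convexHull_min (Set.range_subset_iff.2 hσ) hS (h.vertex_mem i)

/-- The barycentric matrix is invertible and has row sums one, so it transports affine relations
among the vertices in both directions without changing the sum of the coefficients. -/
theorem affineIndependent_iff {ρ σ : Fin 3 → R5} (h : IsPosSub ρ σ) :
    AffineIndependent ℝ ρ ↔ AffineIndependent ℝ σ := by
  obtain ⟨M, M0, M1, Md, hM⟩ := h
  have key : ∀ w : Fin 3 → ℝ, ∑ j, w j • ρ j = ∑ j, (Matrix.vecMul w M) j • σ j := by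
    intro w
    simp only [Matrix.vecMul, dotProduct, hM, Finset.smul_sum, Finset.sum_smul, mul_smul]
    rw [Finset.sum_comm]
  have key1 : ∀ w : Fin 3 → ℝ, ∑ j, (Matrix.vecMul w M) j = ∑ j, w j := by
    intro w
    simp only [Matrix.vecMul, dotProduct]
    rw [Finset.sum_comm]
    simp [← Finset.mul_sum, M1]
  have hu : IsUnit M.det := Md.ne'.isUnit
  rw [affineIndependent_triangle_iff, affineIndependent_triangle_iff]
  constructor
  · intro h w hw0 hw1 j
    have e : Matrix.vecMul (Matrix.vecMul w M⁻¹) M = w := by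
      rw [Matrix.vecMul_vecMul, Matrix.nonsing_inv_mul M hu, Matrix.vecMul_one]
    have h1 := key1 (Matrix.vecMul w M⁻¹)
    have h2 := key (Matrix.vecMul w M⁻¹)
    rw [e] at h1 h2
    have h3 : Matrix.vecMul w M⁻¹ = 0 := funext (h _ (h1 ▸ hw0) (h2 ▸ hw1))
    rw [← e, h3, Matrix.zero_vecMul]; rfl
  · intro h w hw0 hw1 j
    have h3 : Matrix.vecMul w M = 0 :=
      funext (h _ ((key1 w).trans hw0) ((key w).symm.trans hw1))
    have e : Matrix.vecMul (Matrix.vecMul w M) M⁻¹ = w := by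
      rw [Matrix.vecMul_vecMul, Matrix.mul_nonsing_inv M hu, Matrix.vecMul_one]
    rw [← e, h3, Matrix.zero_vecMul]; rfl

/-- Maps that are affine on a triangle respect subtriangles. -/
theorem image {ρ σ : Fin 3 → R5} (h : IsPosSub ρ σ) {F : R5 → R5} {f : R5 →ᵃ[ℝ] R5}
    (hF : Set.EqOn F f (convexHull ℝ (Set.range σ))) : IsPosSub (F ∘ ρ) (F ∘ σ) := by
  have hv := h.vertex_mem
  obtain ⟨M, M0, M1, Md, hM⟩ := h
  refine ⟨M, M0, M1, Md, fun i => ?_⟩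
  have : ∀ j, F (σ j) = f (σ j) := fun j => hF (subset_convexHull ℝ _ ⟨j, rfl⟩)
  simp only [Function.comp, this]
  rw [hF (hv i), hM, f.map_stochastic_sum (M1 i)]

/-- Subtriangles of the image under a map that is affine on a triangle are images. -/
theorem exists_of_image {ρ σ : Fin 3 → R5} {F : R5 → R5} {f : R5 →ᵃ[ℝ] R5}
    (hF : Set.EqOn F f (convexHull ℝ (Set.range σ))) (h : IsPosSub ρ (F ∘ σ)) :
    ∃ ρ', IsPosSub ρ' σ ∧ ρ = F ∘ ρ' := by
  obtain ⟨M, M0, M1, Md, hM⟩ := h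
  have h' : IsPosSub (fun i => ∑ j, M i j • σ j) σ := ⟨M, M0, M1, Md, fun i => rfl⟩
  refine ⟨_, h', funext fun i => ?_⟩
  have : ∀ j, F (σ j) = f (σ j) := fun j => hF (subset_convexHull ℝ _ ⟨j, rfl⟩)
  simp only [hM, Function.comp, this]
  rw [hF (h'.vertex_mem i), f.map_stochastic_sum (M1 i)]

end IsPosSub

theorem flipTriangle_flipTriangle (ρ : Fin 3 → R5) : flipTriangle (flipTriangle ρ) = ρ := by
  funext i; simp [flipTriangle]

theorem range_flipTriangle (ρ : Fin 3 → R5) : Set.range (flipTriangle ρ) = Set.range ρ :=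
  (Equiv.swap (0 : Fin 3) 1).surjective.range_comp ρ

theorem comp_flipTriangle (F : R5 → R5) (ρ : Fin 3 → R5) :
    flipTriangle (F ∘ ρ) = F ∘ flipTriangle ρ := rfl

theorem affineIndependent_flipTriangle {ρ : Fin 3 → R5} :
    AffineIndependent ℝ (flipTriangle ρ) ↔ AffineIndependent ℝ ρ :=
  affineIndependent_equiv (Equiv.swap (0 : Fin 3) 1)

/-- A map that is affine and injective on a triangle preserves nondegeneracy. -/
theorem AffineIndependent.image_triangle {τ : Fin 3 → R5} (hτ : AffineIndependent ℝ τ) {F : R5 → R5}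
    {f : R5 →ᵃ[ℝ] R5} (hF : Set.EqOn F f (convexHull ℝ (Set.range τ)))
    (hi : Set.InjOn F (convexHull ℝ (Set.range τ))) : AffineIndependent ℝ (F ∘ τ) := by
  have hv : ∀ j, F (τ j) = f (τ j) := fun j => hF (subset_convexHull ℝ _ ⟨j, rfl⟩)
  rw [affineIndependent_triangle_iff] at hτ ⊢
  intro w h0 h1
  by_contra! hne
  obtain ⟨j₀, hj₀⟩ := hne
  -- A nontrivial affine relation `w` among the image vertices is scaled so that adding it to the
  -- barycentric weights 1/3 keeps them nonnegative. The barycentre and the perturbed point then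
  -- have the same image, which contradicts injectivity.
  set C := ∑ j, |w j| with hC
  have hle : ∀ j, |w j| ≤ C := fun j =>
    Finset.single_le_sum (f := fun j => |w j|) (fun _ _ => abs_nonneg _) (Finset.mem_univ j)
  have hCpos : 0 < C := (abs_pos.2 hj₀).trans_le (hle j₀)
  let a : Fin 3 → ℝ := fun _ => 1 / 3
  let b : Fin 3 → ℝ := fun j => 1 / 3 + w j / (3 * C)
  have ha1 : ∑ j, a j = 1 := by simp [a]
  have hb1 : ∑ j, b j = 1 := by
    simp only [b, Finset.sum_add_distrib, ← Finset.sum_div, h0]; simp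
  have hb0 : ∀ j, 0 ≤ b j := fun j => by
    have : -(w j / (3 * C)) ≤ 1 / 3 := by
      rw [← neg_div, div_le_div_iff₀ (by positivity) (by norm_num)]
      linarith [neg_le_abs (w j), hle j]
    simp only [b]; linarith
  have hma : ∑ j, a j • τ j ∈ convexHull ℝ (Set.range τ) :=
    mem_convexHull_triangle.2 ⟨a, fun j => by simp only [a]; positivity, ha1, rfl⟩
  have hmb : ∑ j, b j • τ j ∈ convexHull ℝ (Set.range τ) :=
    mem_convexHull_triangle.2 ⟨b, hb0, hb1, rfl⟩
  have hd : ∀ g : Fin 3 → R5, ∑ j, b j • g j = ∑ j, a j • g j + (1 / (3 * C)) • ∑ j, w j • g j := by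
    intro g
    simp only [b, a, add_smul, Finset.sum_add_distrib, Finset.smul_sum, smul_smul]
    congr 1
    exact Finset.sum_congr rfl fun j _ => by ring_nf
  have heq : F (∑ j, b j • τ j) = F (∑ j, a j • τ j) := by
    rw [hF hma, hF hmb, f.map_stochastic_sum ha1, f.map_stochastic_sum hb1, hd]
    simp only [Function.comp, hv] at h1
    rw [h1, smul_zero, add_zero]
  have h2 := hi hmb hma heq
  rw [hd, add_eq_left, smul_eq_zero] at h2
  have h3 : ∑ j, w j • τ j = 0 := h2.resolve_left (by positivity)
  exact hj₀ (hτ w h0 h3 j₀)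

/-- A triangle with a real-valued function on its vertices contains a subtriangle on one side of a
given level. -/
theorem exists_stochastic_le_or_ge (w : Fin 3 → ℝ) (c : ℝ) :
    ∃ M : Matrix (Fin 3) (Fin 3) ℝ, (∀ i j, 0 ≤ M i j) ∧ (∀ i, ∑ j, M i j = 1) ∧ 0 < M.det ∧
      ((∀ i, ∑ j, M i j * w j ≤ c) ∨ ∀ i, c ≤ ∑ j, M i j * w j) := by
  by_cases h : ∀ i, w i ≤ c
  · refine ⟨1, fun i j => by by_cases h : i = j <;> simp [Matrix.one_apply, h], fun i => by
      simp [Matrix.one_apply], by simp, Or.inl fun i => by simpa [Matrix.one_apply] using h i⟩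
  push Not at h
  obtain ⟨k, hk⟩ := h
  set D := ∑ j, |w j - w k| with hD
  have hle : ∀ j, |w j - w k| ≤ D := fun j =>
    Finset.single_le_sum (f := fun j => |w j - w k|) (fun _ _ => abs_nonneg _) (Finset.mem_univ j)
  have hD0 : 0 ≤ D := (abs_nonneg _).trans (hle k)
  -- Some vertex `k` is above the level. Shrinking the triangle towards `k` by a small ratio `δ`
  -- brings all vertices above the level; the determinant of this homothety in barycentric
  -- coordinates is `δ ^ 2`.
  obtain ⟨δ, hδ0, hδ1, hδ⟩ : ∃ δ : ℝ, 0 < δ ∧ δ < 1 ∧ δ * D ≤ w k - c := by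
    refine ⟨min (1 / 2) ((w k - c) / (D + 1)), lt_min (by norm_num)
      (div_pos (by linarith) (by linarith)), (min_le_left _ _).trans_lt (by norm_num), ?_⟩
    calc _ ≤ (w k - c) / (D + 1) * (D + 1) :=
          mul_le_mul (min_le_right _ _) (by linarith) hD0
            (div_nonneg (by linarith) (by linarith))
      _ = w k - c := div_mul_cancel₀ _ (by linarith)
  refine ⟨Matrix.of fun i j => (if j = k then 1 - δ else 0) + (if i = j then δ else 0), ?_, ?_, ?_,
    Or.inr fun i => ?_⟩
  · intro i j
    have : 0 ≤ 1 - δ := by linarith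
    rw [Matrix.of_apply]
    split_ifs <;> linarith
  · intro i
    simp [Finset.sum_add_distrib]
  · rw [Matrix.det_fin_three]
    fin_cases k <;> simp <;> positivity
  · have : ∑ j, ((if j = k then 1 - δ else 0) + (if i = j then δ else 0)) * w j =
        (1 - δ) * w k + δ * w i := by
      simp [add_mul, Finset.sum_add_distrib, ite_mul]
    simp only [Matrix.of_apply, this]
    nlinarith [neg_le_abs (w i - w k), hle i]

theorem IsPosSub.exists_height (τ : Fin 3 → R5) (c : ℝ) :
    ∃ ρ, IsPosSub ρ τ ∧ ((∀ i, (ρ i).2 ≤ c) ∨ ∀ i, c ≤ (ρ i).2) := by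
  obtain ⟨M, M0, M1, Md, h⟩ := exists_stochastic_le_or_ge (fun i => (τ i).2) c
  refine ⟨fun i => ∑ j, M i j • τ j, ⟨M, M0, M1, Md, fun i => rfl⟩, ?_⟩
  simpa [Prod.snd_sum] using h

/-- A nondegenerate triangle is not contained in a finite union of segments. -/
theorem AffineIndependent.not_subset_segments {τ : Fin 3 → R5} (hτ : AffineIndependent ℝ τ)
    {W : Set (R5 × R5)} (hW : W.Finite) :
    ¬ convexHull ℝ (Set.range τ) ⊆ ⋃ w ∈ W, segment ℝ w.1 w.2 := by
  intro hsub
  rw [affineIndependent_triangle_iff] at hτ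
  -- A parabolic arc inside the triangle. Finitely many segments covering it would include one
  -- meeting it in infinitely many points, but three distinct points of a parabola are never
  -- collinear.
  let a : ℝ → Fin 3 → ℝ := fun t => ![1 - t - t ^ 2, t, t ^ 2]
  have ha1 : ∀ t, ∑ j, a t j = 1 := fun t => by simp [a, Fin.sum_univ_three]; ring
  have hmem : ∀ t ∈ Set.Icc (0 : ℝ) (1 / 2), ∑ j, a t j • τ j ∈ convexHull ℝ (Set.range τ) := by
    intro t ht
    refine mem_convexHull_triangle.2 ⟨a t, fun j => ?_, ha1 t, rfl⟩
    obtain ⟨h0, h1⟩ := ht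
    fin_cases j <;> simp [a] <;> nlinarith
  obtain ⟨w, hw⟩ : ∃ w : R5 × R5, {t | ∑ j, a t j • τ j ∈ segment ℝ w.1 w.2}.Infinite := by
    by_contra! hfin
    refine Set.Icc_infinite (show (0 : ℝ) < 1 / 2 by norm_num)
      ((hW.biUnion fun w _ => hfin w).subset fun t ht => ?_)
    simpa using hsub (hmem t ht)
  obtain ⟨T, hT, hcard⟩ := hw.exists_subset_card_eq 3
  obtain ⟨x, y, z, hxy, hxz, hyz, rfl⟩ := Finset.card_eq_three.1 hcard
  have hs : ∀ t ∈ ({x, y, z} : Finset ℝ), ∃ s : ℝ,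
      ∑ j, a t j • τ j = (1 - s) • w.1 + s • w.2 := by
    intro t ht
    obtain ⟨b, s, -, -, hbs, he⟩ := hT ht
    exact ⟨s, by rw [← he, ← hbs]; simp⟩
  obtain ⟨s₁, h₁⟩ := hs x (by simp)
  obtain ⟨s₂, h₂⟩ := hs y (by simp)
  obtain ⟨s₃, h₃⟩ := hs z (by simp)
  have hrel : ∀ c₁ c₂ c₃ : ℝ, c₁ + c₂ + c₃ = 0 → c₁ * s₁ + c₂ * s₂ + c₃ * s₃ = 0 →
      ∀ j, c₁ * a x j + c₂ * a y j + c₃ * a z j = 0 := by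
    intro c₁ c₂ c₃ hc hcs
    refine hτ _ ?_ ?_
    · simp only [Finset.sum_add_distrib, ← Finset.mul_sum, ha1]
      linarith
    · simp only [add_smul, Finset.sum_add_distrib, mul_smul, ← Finset.smul_sum, h₁, h₂, h₃]
      have e : c₃ = -c₁ - c₂ := by linarith
      subst e
      have : c₁ • ((1 - s₁) • w.1 + s₁ • w.2) + c₂ • ((1 - s₂) • w.1 + s₂ • w.2) +
          (-c₁ - c₂) • ((1 - s₃) • w.1 + s₃ • w.2) =
          (c₁ * s₁ + c₂ * s₂ + (-c₁ - c₂) * s₃) • (w.2 - w.1) := by module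
      rw [this, hcs, zero_smul]
  have hne : s₁ ≠ s₂ := by
    rintro rfl
    have := hrel 1 (-1) 0 (by ring) (by ring) 1
    simp [a] at this
    exact hxy (by linarith)
  have hj := hrel (s₂ - s₃) (s₃ - s₁) (s₁ - s₂) (by ring) (by ring)
  have hj1 := hj 1
  have hj2 := hj 2
  simp [a] at hj1 hj2
  -- The Vandermonde determinant of the three parameters, obtained from the relation among three
  -- points on one line.
  have : (s₁ - s₂) * ((z - x) * (z - y)) = 0 := by linear_combination hj2 - (x + y) * hj1
  simp [sub_eq_zero, hne, hxz.symm, hyz.symm] at this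

/-! ### Vertical affine maps -/

/-- The map `(x, t) ↦ (x, a t + b)`. -/
def vert (a b : ℝ) (p : R5) : R5 := (p.1, a * p.2 + b)

/-- `vert` as an affine map. -/
noncomputable def vertAffine (a b : ℝ) : R5 →ᵃ[ℝ] R5 :=
  (LinearMap.prodMap LinearMap.id (a • LinearMap.id)).toAffineMap + AffineMap.const ℝ R5 (0, b)

theorem coe_vertAffine (a b : ℝ) : ⇑(vertAffine a b) = vert a b := by
  funext p
  simp [vertAffine, vert]

theorem vert_one_zero : vert 1 0 = id := by
  funext p; simp [vert]

theorem vert_comp_vert (a b a' b' : ℝ) : vert a' b' ∘ vert a b = vert (a' * a) (a' * b + b') := by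
  funext p; simp [vert]; ring

theorem vert_inv_comp {a : ℝ} (ha : a ≠ 0) (b : ℝ) : vert a⁻¹ (-(a⁻¹ * b)) ∘ vert a b = id := by
  rw [vert_comp_vert, inv_mul_cancel₀ ha, add_neg_cancel, vert_one_zero]

theorem vert_comp_inv {a : ℝ} (ha : a ≠ 0) (b : ℝ) : vert a b ∘ vert a⁻¹ (-(a⁻¹ * b)) = id := by
  rw [vert_comp_vert, mul_inv_cancel₀ ha, mul_neg, mul_inv_cancel_left₀ ha, neg_add_cancel,
    vert_one_zero]

theorem vert_injective {a : ℝ} (ha : a ≠ 0) (b : ℝ) : Function.Injective (vert a b) :=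
  Function.LeftInverse.injective (congrFun (vert_inv_comp ha b))

theorem IsPosSub.vert {ρ σ : Fin 3 → R5} (h : IsPosSub ρ σ) (a b : ℝ) :
    IsPosSub (vert a b ∘ ρ) (vert a b ∘ σ) :=
  h.image (f := vertAffine a b) fun p _ => by rw [coe_vertAffine]

theorem isPosSub_vert_iff {ρ σ : Fin 3 → R5} {a : ℝ} (ha : a ≠ 0) (b : ℝ) :
    IsPosSub (vert a b ∘ ρ) (vert a b ∘ σ) ↔ IsPosSub ρ σ := by
  refine ⟨fun h => ?_, fun h => h.vert a b⟩
  have := h.vert a⁻¹ (-(a⁻¹ * b))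
  rwa [← Function.comp_assoc, ← Function.comp_assoc, vert_inv_comp ha] at this

theorem IsPosSub.exists_of_vert {ρ σ : Fin 3 → R5} {a b : ℝ} (h : IsPosSub ρ (_root_.vert a b ∘ σ)) :
    ∃ ρ', IsPosSub ρ' σ ∧ ρ = _root_.vert a b ∘ ρ' :=
  IsPosSub.exists_of_image (f := vertAffine a b) (fun p _ => by rw [coe_vertAffine]) h

theorem AffineIndependent.vert {τ : Fin 3 → R5} (h : AffineIndependent ℝ τ) {a : ℝ} (ha : a ≠ 0)
    (b : ℝ) : AffineIndependent ℝ (_root_.vert a b ∘ τ) :=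
  h.image_triangle (f := vertAffine a b) (fun p _ => by rw [coe_vertAffine])
    (vert_injective ha b).injOn

theorem convex_height_Icc (c d : ℝ) : Convex ℝ {p : R5 | c ≤ p.2 ∧ p.2 ≤ d} :=
  (convex_Icc c d).is_linear_preimage (IsLinearMap.mk (f := fun p : R5 => p.2) (fun _ _ => rfl) fun _ _ => rfl)

namespace TwoComplex

theorem lowerHalf_eq_vert : lowerHalf = vert (1 / 2) 0 := by
  funext p; simp [lowerHalf, vert]; ring

theorem upperHalf_eq_vert : upperHalf = vert (1 / 2) (1 / 2) := by
  funext p; simp [upperHalf, vert]; ring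

/-! ### Negatively oriented triangles -/

/-- `ρ` lies in a triangle of `K` with the opposite orientation. -/
def Neg (K : TwoComplex) (ρ : Fin 3 → R5) : Prop :=
  ∃ σ ∈ K.cells, IsPosSub (flipTriangle ρ) σ

/-- `K` is negatively oriented somewhere on `τ`. -/
def NegIn (K : TwoComplex) (τ : Fin 3 → R5) : Prop :=
  ∃ ρ, IsPosSub ρ τ ∧ K.Neg ρ

variable {K L N : TwoComplex}

theorem positive_iff {τ : Fin 3 → R5} : K.Positive τ ↔
    AffineIndependent ℝ τ ∧ convexHull ℝ (Set.range τ) ⊆ K.carrier ∧ ¬ K.NegIn τ := by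
  simp only [Positive, NegIn, Neg]
  refine and_congr_right fun _ => and_congr_right fun _ => ?_
  push Not
  exact ⟨fun h ρ h1 σ h2 => h σ h2 ρ h1, fun h σ h2 ρ h1 => h ρ h1 σ h2⟩

theorem Neg.of_sub {ρ ρ' : Fin 3 → R5} (h : K.Neg ρ) (h' : IsPosSub ρ' ρ) : K.Neg ρ' :=
  let ⟨σ, hσ, hs⟩ := h
  ⟨σ, hσ, h'.flip.trans hs⟩

theorem Neg.negIn {ρ : Fin 3 → R5} (h : K.Neg ρ) : K.NegIn ρ := ⟨ρ, .refl ρ, h⟩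

theorem NegIn.of_sub {ρ τ : Fin 3 → R5} (h : K.NegIn ρ) (h' : IsPosSub ρ τ) : K.NegIn τ :=
  let ⟨ρ', h1, h2⟩ := h
  ⟨ρ', h1.trans h', h2⟩

theorem convexHull_subset_carrier {σ : Fin 3 → R5} (hσ : σ ∈ K.cells) :
    convexHull ℝ (Set.range σ) ⊆ K.carrier :=
  fun _ hp => Or.inl (Set.mem_biUnion hσ hp)

theorem Neg.subset_carrier {ρ : Fin 3 → R5} (h : K.Neg ρ) :
    convexHull ℝ (Set.range ρ) ⊆ K.carrier := by
  obtain ⟨σ, hσ, hs⟩ := h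
  rw [← range_flipTriangle]
  exact hs.convexHull_subset.trans (convexHull_subset_carrier hσ)

theorem Neg.mem_carrier {ρ : Fin 3 → R5} (h : K.Neg ρ) (i : Fin 3) : ρ i ∈ K.carrier :=
  h.subset_carrier (subset_convexHull ℝ _ ⟨i, rfl⟩)

theorem Neg.affineIndependent {ρ : Fin 3 → R5} (h : K.Neg ρ) (hK : K.IsOriented) :
    AffineIndependent ℝ ρ := by
  obtain ⟨σ, hσ, hs⟩ := h
  rw [← affineIndependent_flipTriangle]
  exact hs.affineIndependent_iff.2 (hK.nondegenerate σ hσ)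

/-- Negativity is witnessed by a subtriangle that can be shrunk to one side of any level; this is
what allows comparisons to be glued along levels. -/
theorem NegIn.exists_height {τ : Fin 3 → R5} (h : K.NegIn τ) (c : ℝ) :
    ∃ ρ, IsPosSub ρ τ ∧ K.Neg ρ ∧ ((∀ i, (ρ i).2 ≤ c) ∨ ∀ i, c ≤ (ρ i).2) := by
  obtain ⟨ρ, h1, h2⟩ := h
  obtain ⟨ρ', h3, h4⟩ := IsPosSub.exists_height ρ c
  exact ⟨ρ', h3.trans h1, h2.of_sub h3, h4⟩

/-- A negative witness is not positive in `K`, hence not in `L`. Being nondegenerate and contained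
in the carrier of `L`, it can fail to be positive there only by containing a negative subtriangle.
-/
theorem AgreeOn.negIn {S : Set R5} (h : K.AgreeOn L S) (hS : Convex ℝ S) (hK : K.IsOriented)
    {τ : Fin 3 → R5} (hτ : ∀ i, τ i ∈ S) (hn : K.NegIn τ) : L.NegIn τ := by
  obtain ⟨ρ, h1, h2⟩ := hn
  have hρ := h1.mem_of_convex hS hτ
  have h3 : ¬ L.Positive ρ := by
    rw [← h.2 ρ hρ, positive_iff]
    exact fun h' => h'.2.2 h2.negIn
  rw [positive_iff] at h3
  push Not at h3
  refine (h3 (h2.affineIndependent hK) fun p hp => ?_).of_sub h1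
  exact (h.1 p (convexHull_min (Set.range_subset_iff.2 hρ) hS hp)).1 (h2.subset_carrier hp)

theorem AgreeOn.symm {S : Set R5} (h : K.AgreeOn L S) : L.AgreeOn K S :=
  ⟨fun p hp => (h.1 p hp).symm, fun τ hτ => (h.2 τ hτ).symm⟩

/-! ### Complexes that correspond under vertical affine maps -/

/-- `(x, t) ↦ (x, a t + b)` carries the part of `K` at the heights in `[c, d]` to `L`, preserving
orientations. -/
structure Match (K L : TwoComplex) (a b c d : ℝ) : Prop where
  carrier : ∀ p : R5, c ≤ p.2 → p.2 ≤ d → (p ∈ K.carrier ↔ vert a b p ∈ L.carrier)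
  negIn : ∀ τ : Fin 3 → R5, (∀ i, c ≤ (τ i).2 ∧ (τ i).2 ≤ d) →
    (K.NegIn τ ↔ L.NegIn (vert a b ∘ τ))

theorem Match.mono {a b c d c' d' : ℝ} (h : Match K L a b c d) (hc : c ≤ c') (hd : d' ≤ d) :
    Match K L a b c' d' :=
  ⟨fun p h1 h2 => h.carrier p (hc.trans h1) (h2.trans hd),
    fun τ hτ => h.negIn τ fun i => ⟨hc.trans (hτ i).1, (hτ i).2.trans hd⟩⟩

theorem Match.trans {a b c d a' b' c' d' : ℝ} (ha : 0 ≤ a) (h : Match K L a b c d)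
    (h' : Match L N a' b' c' d') (hc : c' ≤ a * c + b) (hd : a * d + b ≤ d') :
    Match K N (a' * a) (a' * b + b') c d := by
  have key : ∀ p : R5, c ≤ p.2 → p.2 ≤ d → c' ≤ (vert a b p).2 ∧ (vert a b p).2 ≤ d' := by
    intro p h1 h2
    have := mul_le_mul_of_nonneg_left h1 ha
    have := mul_le_mul_of_nonneg_left h2 ha
    constructor <;> simp only [vert] <;> linarith
  refine ⟨fun p h1 h2 => ?_, fun τ hτ => ?_⟩
  · rw [h.carrier p h1 h2, h'.carrier _ (key p h1 h2).1 (key p h1 h2).2,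
      ← vert_comp_vert a b a' b', Function.comp]
  · rw [h.negIn τ hτ, h'.negIn (vert a b ∘ τ) fun i => key (τ i) (hτ i).1 (hτ i).2,
      ← vert_comp_vert a b a' b', Function.comp_assoc]

theorem Match.symm {a b c d : ℝ} (ha : 0 < a) (h : Match K L a b c d) :
    Match L K a⁻¹ (-(a⁻¹ * b)) (a * c + b) (a * d + b) := by
  have key : ∀ p : R5, a * c + b ≤ p.2 → p.2 ≤ a * d + b →
      c ≤ (vert a⁻¹ (-(a⁻¹ * b)) p).2 ∧ (vert a⁻¹ (-(a⁻¹ * b)) p).2 ≤ d := by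
    intro p h1 h2
    have e : (vert a⁻¹ (-(a⁻¹ * b)) p).2 = (p.2 - b) / a := by
      simp only [vert]; ring
    rw [e, le_div_iff₀ ha, div_le_iff₀ ha]
    constructor <;> linarith
  refine ⟨fun p h1 h2 => ?_, fun τ hτ => ?_⟩
  · rw [h.carrier _ (key p h1 h2).1 (key p h1 h2).2]
    rw [show vert a b (vert a⁻¹ (-(a⁻¹ * b)) p) = p from congrFun (vert_comp_inv ha.ne' b) p]
  · rw [h.negIn (vert a⁻¹ (-(a⁻¹ * b)) ∘ τ) fun i => key (τ i) (hτ i).1 (hτ i).2, ← Function.comp_assoc,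
      vert_comp_inv ha.ne', Function.id_comp]

/-- A triangle may cross the level `d`, but a negative witness in it can be chosen on one side,
where one of the two hypotheses applies. -/
theorem Match.join {a b c d e : ℝ} (ha : 0 < a) (h : Match K L a b c d) (h' : Match K L a b d e) :
    Match K L a b c e := by
  refine ⟨fun p h1 h2 => ?_, fun τ hτ => ⟨fun hn => ?_, fun hn => ?_⟩⟩
  · rcases le_total p.2 d with hd | hd
    exacts [h.carrier p h1 hd, h'.carrier p hd h2]
  · obtain ⟨ρ, h1, h2, h3⟩ := hn.exists_height d
    have hρ := h1.mem_of_convex (convex_height_Icc c e) hτ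
    rcases h3 with h3 | h3
    · exact ((h.negIn ρ fun i => ⟨(hρ i).1, h3 i⟩).1 h2.negIn).of_sub (h1.vert a b)
    · exact ((h'.negIn ρ fun i => ⟨h3 i, (hρ i).2⟩).1 h2.negIn).of_sub (h1.vert a b)
  · obtain ⟨ρ, h1, h2, h3⟩ := hn.exists_height (a * d + b)
    obtain ⟨ρ, h4, rfl⟩ := h1.exists_of_vert
    have hρ := h4.mem_of_convex (convex_height_Icc c e) hτ
    simp only [Function.comp, vert, add_le_add_iff_right, mul_le_mul_iff_right₀ ha] at h3
    rcases h3 with h3 | h3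
    · exact ((h.negIn ρ fun i => ⟨(hρ i).1, h3 i⟩).2 h2.negIn).of_sub h4
    · exact ((h'.negIn ρ fun i => ⟨h3 i, (hρ i).2⟩).2 h2.negIn).of_sub h4

theorem AgreeOn.match_id {S : Set R5} {c d : ℝ} (h : K.AgreeOn L S) (hS : Convex ℝ S)
    (hK : K.IsOriented) (hL : L.IsOriented) (hcd : ∀ p : R5, c ≤ p.2 → p.2 ≤ d → p ∈ S) :
    Match K L 1 0 c d := by
  refine ⟨fun p h1 h2 => ?_, fun τ hτ => ?_⟩
  · rw [vert_one_zero]; exact h.1 p (hcd p h1 h2)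
  · rw [vert_one_zero, Function.id_comp]
    have hτ' := fun i => hcd (τ i) (hτ i).1 (hτ i).2
    exact ⟨h.negIn hS hK hτ', h.symm.negIn hS hL hτ'⟩

/-- Only heights in `[0, 1]` have to be controlled: the carriers, and with them all negative
witnesses, lie in the slab. -/
theorem Match.agreeOn {S : Set R5} {c d : ℝ} (h : Match K L 1 0 c d) (hS : Convex ℝ S)
    (hK : K.carrier ⊆ slab) (hL : L.carrier ⊆ slab)
    (hcd : ∀ p ∈ S, 0 ≤ p.2 → p.2 ≤ 1 → c ≤ p.2 ∧ p.2 ≤ d) : K.AgreeOn L S := by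
  have hc : ∀ p ∈ S, p ∈ K.carrier ↔ p ∈ L.carrier := by
    intro p hp
    by_cases h0 : 0 ≤ p.2 ∧ p.2 ≤ 1
    · have := hcd p hp h0.1 h0.2
      have := h.carrier p this.1 this.2
      rwa [vert_one_zero] at this
    · exact ⟨fun h' => absurd (hK h').2 h0, fun h' => absurd (hL h').2 h0⟩
  refine ⟨hc, fun τ hτ => ?_⟩
  have hn : ∀ ρ : Fin 3 → R5, (∀ i, ρ i ∈ S) → (∀ i, ρ i ∈ slab) → (K.NegIn ρ ↔ L.NegIn ρ) := by
    intro ρ h1 h2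
    have := h.negIn ρ fun i => hcd (ρ i) (h1 i) (h2 i).2.1 (h2 i).2.2
    rwa [vert_one_zero, Function.id_comp] at this
  rw [positive_iff, positive_iff]
  refine and_congr_right fun _ => and_congr ?_ (not_congr ⟨?_, ?_⟩)
  · have hτS := convexHull_min (Set.range_subset_iff.2 hτ) hS
    exact forall₂_congr fun p hp => hc p (hτS hp)
  · rintro ⟨ρ, h1, h2⟩
    exact ((hn ρ (h1.mem_of_convex hS hτ) fun i => hK (h2.mem_carrier i)).1 h2.negIn).of_sub h1
  · rintro ⟨ρ, h1, h2⟩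
    exact ((hn ρ (h1.mem_of_convex hS hτ) fun i => hL (h2.mem_carrier i)).2 h2.negIn).of_sub h1

end TwoComplex

/-! ### Triangles in the wall above an edge -/

/-- Twice the signed area of the planar triangle with the vertices `(u i, t i)`. -/
def signedArea (u t : Fin 3 → ℝ) : ℝ := (u 1 - u 0) * (t 2 - t 0) - (u 2 - u 0) * (t 1 - t 0)

theorem signedArea_stochastic {M : Matrix (Fin 3) (Fin 3) ℝ} (hM : ∀ i, ∑ j, M i j = 1)
    (u t : Fin 3 → ℝ) : signedArea (fun i => ∑ j, M i j * u j) (fun i => ∑ j, M i j * t j) =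
      M.det * signedArea u t := by
  simp only [Fin.sum_univ_three] at hM ⊢
  have h : ∀ i, M i 2 = 1 - M i 0 - M i 1 := fun i => by linarith [hM i]
  simp only [signedArea, Matrix.det_fin_three, h]
  ring

/-- The vertices of `ρ` lie in the vertical strip over the edge `e`, with horizontal coordinates
`u`, and `ρ` is oriented like the cylinder. -/
def PosWallCoord (e : R4 × R4) (ρ : Fin 3 → R5) (u : Fin 3 → ℝ) : Prop :=
  (∀ i, 0 ≤ u i ∧ u i ≤ 1) ∧ (∀ i, (ρ i).1 = (1 - u i) • e.1 + u i • e.2) ∧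
    0 < signedArea u fun i => (ρ i).2

/-- `ρ` lies in the vertical strip over the edge `e` and is oriented like the cylinder. -/
def PosWall (e : R4 × R4) (ρ : Fin 3 → R5) : Prop :=
  ∃ u, PosWallCoord e ρ u

theorem PosWallCoord.stochastic {e : R4 × R4} {ρ σ : Fin 3 → R5} {u : Fin 3 → ℝ}
    (h : PosWallCoord e σ u) {M : Matrix (Fin 3) (Fin 3) ℝ} (M0 : ∀ i j, 0 ≤ M i j)
    (M1 : ∀ i, ∑ j, M i j = 1) (Md : 0 < M.det) (hM : ∀ i, ρ i = ∑ j, M i j • σ j) :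
    PosWallCoord e ρ fun i => ∑ j, M i j * u j := by
  obtain ⟨h01, hu, ha⟩ := h
  refine ⟨fun i => ⟨?_, ?_⟩, fun i => ?_, ?_⟩
  · exact Finset.sum_nonneg fun j _ => mul_nonneg (M0 i j) (h01 j).1
  · rw [← M1 i]
    exact Finset.sum_le_sum fun j _ => mul_le_of_le_one_right (M0 i j) (h01 j).2
  · rw [hM, Prod.fst_sum]
    simp only [Prod.smul_fst, hu]
    have h2 : M i 2 = 1 - M i 0 - M i 1 := by
      have := M1 i; rw [Fin.sum_univ_three] at this; linarith
    simp only [Fin.sum_univ_three, h2]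
    module
  · have := signedArea_stochastic M1 u fun i => (σ i).2
    have e2 : (fun i => (ρ i).2) = fun i => ∑ j, M i j * (σ j).2 := by
      funext i; rw [hM, Prod.snd_sum]; rfl
    rw [e2, this]
    exact mul_pos Md ha

namespace PosWall

variable {e : R4 × R4} {ρ σ : Fin 3 → R5}

theorem of_sub (h : PosWall e σ) (hs : IsPosSub ρ σ) : PosWall e ρ :=
  let ⟨_, hu⟩ := h
  let ⟨_, M0, M1, Md, hM⟩ := hs
  ⟨_, hu.stochastic M0 M1 Md hM⟩

theorem vert (h : PosWall e ρ) {a : ℝ} (ha : 0 < a) (b : ℝ) : PosWall e (_root_.vert a b ∘ ρ) := by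
  obtain ⟨u, h01, hu, hpos⟩ := h
  refine ⟨u, h01, hu, ?_⟩
  have : signedArea u (fun i => ((_root_.vert a b ∘ ρ) i).2) =
      a * signedArea u fun i => (ρ i).2 := by
    simp only [signedArea, Function.comp, _root_.vert]; ring
  rw [this]
  exact mul_pos ha hpos

theorem fst_mem_segment (h : PosWall e ρ) {p : R5} (hp : p ∈ convexHull ℝ (Set.range ρ)) :
    p.1 ∈ segment ℝ e.1 e.2 := by
  obtain ⟨u, h01, hu, -⟩ := h
  have hc : Convex ℝ {p : R5 | p.1 ∈ segment ℝ e.1 e.2} :=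
    (convex_segment e.1 e.2).is_linear_preimage
      (IsLinearMap.mk (f := fun p : R5 => p.1) (fun _ _ => rfl) fun _ _ => rfl)
  refine convexHull_min (Set.range_subset_iff.2 fun i => ?_) hc hp
  exact ⟨1 - u i, u i, by linarith [(h01 i).2], (h01 i).1, by ring, (hu i).symm⟩

theorem affineIndependent (h : PosWall e ρ) (he : e.1 ≠ e.2) : AffineIndependent ℝ ρ := by
  obtain ⟨u, -, hu, hpos⟩ := h
  rw [affineIndependent_triangle_iff]
  intro w h0 h1
  have hx := congrArg Prod.fst h1
  have ht := congrArg Prod.snd h1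
  simp only [Fin.sum_univ_three, Prod.fst_add, Prod.snd_add, Prod.smul_fst, Prod.smul_snd, hu,
    Prod.fst_zero, Prod.snd_zero, smul_eq_mul] at h0 hx ht
  have h2 : w 0 = -w 1 - w 2 := by linarith
  have hx' : (w 0 * u 0 + w 1 * u 1 + w 2 * u 2) • (e.2 - e.1) = 0 := by
    rw [← hx, h2]; module
  have hx2 := (smul_eq_zero.1 hx').resolve_right (sub_ne_zero.2 he.symm)
  rw [h2] at hx2 ht
  have e1 : w 1 * signedArea u (fun i => (ρ i).2) = 0 := by
    simp only [signedArea]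
    linear_combination ((ρ 2).2 - (ρ 0).2) * hx2 - (u 2 - u 0) * ht
  have e2 : w 2 * signedArea u (fun i => (ρ i).2) = 0 := by
    simp only [signedArea]
    linear_combination -((ρ 1).2 - (ρ 0).2) * hx2 + (u 1 - u 0) * ht
  have e1 := (mul_eq_zero.1 e1).resolve_right hpos.ne'
  have e2 := (mul_eq_zero.1 e2).resolve_right hpos.ne'
  intro j
  fin_cases j
  · simp [h2, e1, e2]
  · exact e1
  · exact e2

/-- The two ends of the edge are distinct, so horizontal coordinates are unique, and exchanging two
vertices changes the sign of the area. -/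
theorem not_flip (h : PosWall e ρ) (he : e.1 ≠ e.2) : ¬ PosWall e (flipTriangle ρ) := by
  rintro ⟨v, -, hv, hpos'⟩
  obtain ⟨u, -, hu, hpos⟩ := h
  have key : ∀ i, v i = u (Equiv.swap 0 1 i) := by
    intro i
    have h1 := hv i
    rw [flipTriangle, Function.comp, hu] at h1
    have h2 : (v i - u (Equiv.swap 0 1 i)) • (e.2 - e.1) = 0 := by
      rw [← sub_eq_zero] at h1
      rw [← neg_eq_zero, ← h1]; module
    exact sub_eq_zero.1 ((smul_eq_zero.1 h2).resolve_right (sub_ne_zero.2 he.symm))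
  have h2 : (Equiv.swap (0 : Fin 3) 1) 2 = 2 := by decide
  simp only [signedArea, key, flipTriangle, Function.comp, Equiv.swap_apply_left,
    Equiv.swap_apply_right, h2] at hpos hpos'
  linarith

end PosWall

/-! ### The cylinder as a union of walls over the edges -/

namespace TwoComplex

variable {G H : SpatialGraph}

theorem posWall_of_mem_cells {σ : Fin 3 → R5} (h : σ ∈ (cylinder G).cells) :
    ∃ e ∈ G.edges, PosWall e σ := by
  obtain ⟨e, he, rfl | rfl⟩ := h
  · refine ⟨e, he, ![0, 1, 0], fun i => ?_, fun i => ?_, ?_⟩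
    · fin_cases i <;> simp
    · fin_cases i <;> simp
    · simp [signedArea]
  · refine ⟨e, he, ![1, 1, 0], fun i => ?_, fun i => ?_, ?_⟩
    · fin_cases i <;> simp
    · fin_cases i <;> simp
    · simp [signedArea]

/-- The diagonal of the rectangle over `e` is the line where horizontal coordinate and height add up
to 1. A triangle on one side of it lies in one of the two cells; the matrices below are the
barycentric coordinates in those cells, and their determinant is the signed area. -/
theorem _root_.PosWallCoord.exists_cell {e : R4 × R4} {τ : Fin 3 → R5} {v : Fin 3 → ℝ}
    (h : PosWallCoord e τ v) (he : e ∈ G.edges) (ht : ∀ i, 0 ≤ (τ i).2 ∧ (τ i).2 ≤ 1)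
    (hd : (∀ i, v i + (τ i).2 ≤ 1) ∨ ∀ i, 1 ≤ v i + (τ i).2) :
    ∃ σ ∈ (cylinder G).cells, IsPosSub τ σ := by
  obtain ⟨hv01, hv, hpos⟩ := h
  rcases hd with hd | hd
  · refine ⟨_, ⟨e, he, Or.inl rfl⟩, Matrix.of fun i => ![1 - v i - (τ i).2, v i, (τ i).2],
      fun i j => ?_, fun i => ?_, ?_, fun i => Prod.ext ?_ ?_⟩
    · have := hd i
      fin_cases j <;> simp <;> linarith [hv01 i, ht i]
    · simp [Fin.sum_univ_three]; ring
    · convert hpos using 1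
      simp [Matrix.det_fin_three, signedArea]; ring
    · rw [hv]; simp only [Fin.sum_univ_three, Prod.fst_add, Prod.smul_fst]; simp; module
    · simp [Fin.sum_univ_three]
  · refine ⟨_, ⟨e, he, Or.inr rfl⟩, Matrix.of fun i => ![1 - (τ i).2, v i + (τ i).2 - 1, 1 - v i],
      fun i j => ?_, fun i => ?_, ?_, fun i => Prod.ext ?_ ?_⟩
    · have := hd i
      fin_cases j <;> simp <;> linarith [hv01 i, ht i]
    · simp [Fin.sum_univ_three]
    · convert hpos using 1
      simp [Matrix.det_fin_three, signedArea]; ring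
    · rw [hv]; simp only [Fin.sum_univ_three, Prod.fst_add, Prod.smul_fst]; simp; module
    · simp [Fin.sum_univ_three]

theorem _root_.PosWall.exists_sub_cell {e : R4 × R4} {ρ : Fin 3 → R5} (h : PosWall e ρ)
    (he : e ∈ G.edges) (ht : ∀ i, 0 ≤ (ρ i).2 ∧ (ρ i).2 ≤ 1) :
    ∃ ρ', IsPosSub ρ' ρ ∧ ∃ σ ∈ (cylinder G).cells, IsPosSub ρ' σ := by
  obtain ⟨u, hu⟩ := h
  obtain ⟨M, M0, M1, Md, hM⟩ := exists_stochastic_le_or_ge (fun i => u i + (ρ i).2) 1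
  have hs : IsPosSub (fun i => ∑ j, M i j • ρ j) ρ := ⟨M, M0, M1, Md, fun i => rfl⟩
  have ht' := hs.mem_of_convex (convex_height_Icc 0 1) ht
  have hv := hu.stochastic (ρ := fun i => ∑ j, M i j • ρ j) M0 M1 Md fun i => rfl
  refine ⟨_, hs, ?_⟩
  have hsum : ∀ i, ∑ j, M i j * (u j + (ρ j).2) =
      (∑ j, M i j * u j) + (∑ j, M i j • ρ j).2 := fun i => by
    simp [mul_add, Finset.sum_add_distrib, Prod.snd_sum]
  simp only [hsum] at hM
  exact hv.exists_cell he ht' hM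

theorem carrier_cylinder : (cylinder G).carrier =
    {p | (p.1 ∈ G.verts ∨ ∃ e ∈ G.edges, p.1 ∈ segment ℝ e.1 e.2) ∧ 0 ≤ p.2 ∧ p.2 ≤ 1} := by
  ext p
  simp only [carrier, Set.mem_union, Set.mem_iUnion, exists_prop, Set.mem_ofPred_eq]
  constructor
  · rintro (⟨σ, hσ, hp⟩ | ⟨w, ⟨v, hv, rfl⟩, hp⟩)
    · obtain ⟨e, he, hw⟩ := posWall_of_mem_cells hσ
      refine ⟨Or.inr ⟨e, he, hw.fst_mem_segment hp⟩, ?_⟩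
      refine convexHull_min (Set.range_subset_iff.2 fun i => ?_) (convex_height_Icc 0 1) hp
      obtain ⟨e, he, rfl | rfl⟩ := hσ <;> fin_cases i <;> simp
    · obtain ⟨h1, h2⟩ := Prod.segment_subset (𝕜 := ℝ) (v, (0 : ℝ)) (v, 1) hp
      rw [segment_same] at h1
      rw [segment_eq_Icc zero_le_one] at h2
      exact ⟨Or.inl (h1 ▸ hv), h2⟩
  · rintro ⟨hv | ⟨e, he, a, u, ha, hu, hau, hp⟩, h0, h1⟩
    · exact Or.inr ⟨_, ⟨p.1, hv, rfl⟩, 1 - p.2, p.2, by linarith, h0, by ring, by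
        ext <;> simp [← add_mul]⟩
    · left
      obtain rfl : a = 1 - u := by linarith
      rcases le_total (u + p.2) 1 with h | h
      · refine ⟨_, ⟨e, he, Or.inl rfl⟩, mem_convexHull_triangle.2
          ⟨![1 - u - p.2, u, p.2], fun j => ?_, ?_, Prod.ext ?_ ?_⟩⟩
        · fin_cases j <;> simp <;> linarith
        · simp [Fin.sum_univ_three]; ring
        · rw [← hp]; simp only [Fin.sum_univ_three, Prod.fst_add, Prod.smul_fst]; simp; module
        · simp [Fin.sum_univ_three]
      · refine ⟨_, ⟨e, he, Or.inr rfl⟩, mem_convexHull_triangle.2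
          ⟨![1 - p.2, u + p.2 - 1, 1 - u], fun j => ?_, ?_, Prod.ext ?_ ?_⟩⟩
        · fin_cases j <;> simp <;> linarith
        · simp [Fin.sum_univ_three]
        · rw [← hp]; simp only [Fin.sum_univ_three, Prod.fst_add, Prod.smul_fst]; simp; module
        · simp [Fin.sum_univ_three]

end TwoComplex

namespace TwoComplex

variable {G H I : SpatialGraph} {A B : TwoComplex}

/-! ### Cylinders -/

theorem carrier_cylinder_subset_slab : (cylinder G).carrier ⊆ slab := by
  rw [carrier_cylinder]
  rintro p ⟨hv | ⟨e, he, hp⟩, h⟩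
  exacts [⟨G.verts_mem _ hv, h⟩, ⟨G.edge_subset e he hp, h⟩]

/-- The right-hand side no longer mentions the diagonals that triangulate the rectangles, so it is
visibly compatible with vertical affine maps. -/
theorem negIn_cylinder_iff {τ : Fin 3 → R5} (hτ : ∀ i, 0 ≤ (τ i).2 ∧ (τ i).2 ≤ 1) :
    (cylinder G).NegIn τ ↔ ∃ ρ, IsPosSub ρ τ ∧ ∃ e ∈ G.edges, PosWall e (flipTriangle ρ) := by
  constructor
  · rintro ⟨ρ, h1, σ, hσ, h2⟩
    obtain ⟨e, he, hw⟩ := posWall_of_mem_cells hσ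
    exact ⟨ρ, h1, e, he, hw.of_sub h2⟩
  · rintro ⟨ρ, h1, e, he, hw⟩
    have hρ := h1.mem_of_convex (convex_height_Icc 0 1) hτ
    obtain ⟨ρ', h3, σ, hσ, h4⟩ := hw.exists_sub_cell he fun i => hρ _
    refine ⟨flipTriangle ρ', ?_, σ, hσ, by rwa [flipTriangle_flipTriangle]⟩
    have := h3.flip
    rw [flipTriangle_flipTriangle] at this
    exact this.trans h1

theorem match_cylinder {a b c d : ℝ} (ha : 0 < a) (hc : 0 ≤ c) (hd : d ≤ 1) (hc' : 0 ≤ a * c + b)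
    (hd' : a * d + b ≤ 1) : Match (cylinder G) (cylinder G) a b c d := by
  have key : ∀ p : R5, c ≤ p.2 → p.2 ≤ d → 0 ≤ (vert a b p).2 ∧ (vert a b p).2 ≤ 1 := by
    intro p h1 h2
    have := mul_le_mul_of_nonneg_left h1 ha.le
    have := mul_le_mul_of_nonneg_left h2 ha.le
    constructor <;> simp only [vert] <;> linarith
  refine ⟨fun p h1 h2 => ?_, fun τ hτ => ?_⟩
  · rw [carrier_cylinder]
    exact and_congr_right fun _ => iff_of_true ⟨hc.trans h1, h2.trans hd⟩ (key p h1 h2)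
  · rw [negIn_cylinder_iff fun i => ⟨hc.trans (hτ i).1, (hτ i).2.trans hd⟩,
      negIn_cylinder_iff (τ := vert a b ∘ τ) fun i => key (τ i) (hτ i).1 (hτ i).2]
    constructor
    · rintro ⟨ρ, h1, e, he, hw⟩
      exact ⟨_, h1.vert a b, e, he, hw.vert ha b⟩
    · rintro ⟨ρ, h1, e, he, hw⟩
      obtain ⟨ρ, h2, rfl⟩ := h1.exists_of_vert
      refine ⟨ρ, h2, e, he, ?_⟩
      have := hw.vert (inv_pos.2 ha) (-(a⁻¹ * b))
      rwa [comp_flipTriangle, ← Function.comp_assoc, vert_inv_comp ha.ne'] at this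

theorem isOriented_cylinder : (cylinder G).IsOriented where
  cells_finite := by
    refine (G.edges.finite_toSet.biUnion fun e _ => Set.toFinite
      {![(e.1, (0 : ℝ)), (e.2, 0), (e.1, 1)], ![(e.2, 0), (e.2, 1), (e.1, 1)]}).subset ?_
    rintro σ ⟨e, he, h⟩
    exact Set.mem_biUnion he h
  wires_finite := by
    refine (G.verts.finite_toSet.image fun v => ((v, (0 : ℝ)), (v, (1 : ℝ)))).subset ?_
    rintro w ⟨v, hv, rfl⟩
    exact ⟨v, hv, rfl⟩
  nondegenerate σ hσ := by
    obtain ⟨e, he, hw⟩ := posWall_of_mem_cells hσ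
    exact hw.affineIndependent (G.ends_ne e he)
  consistent σ hσ τ hτ ρ h1 h2 := by
    obtain ⟨e, he, hw⟩ := posWall_of_mem_cells hσ
    obtain ⟨f, hf, hw'⟩ := posWall_of_mem_cells hτ
    by_cases hef : e = f
    · subst hef
      exact (hw.of_sub h1).not_flip (G.ends_ne e he) (hw'.of_sub h2)
    -- Walls over different edges meet only above common vertices, so a shared triangle would lie in
    -- two vertical segments.
    · refine ((hw.of_sub h1).affineIndependent (G.ends_ne e he)).not_subset_segments
        (Set.toFinite {((e.1, (0 : ℝ)), (e.1, (1 : ℝ))), ((e.2, 0), (e.2, 1))}) fun p hp => ?_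
      have hp' : p ∈ convexHull ℝ (Set.range (flipTriangle ρ)) := by rwa [range_flipTriangle]
      have hm := G.edge_inter e he f hf hef
        ⟨(hw.of_sub h1).fst_mem_segment hp, (hw'.of_sub h2).fst_mem_segment hp'⟩
      have ht : p.2 ∈ Set.Icc (0 : ℝ) 1 := (carrier_cylinder_subset_slab
        (convexHull_subset_carrier hσ (h1.convexHull_subset hp))).2
      have hseg : ∀ v : R4, p.1 = v → p ∈ segment ℝ (v, (0 : ℝ)) (v, 1) := by
        rintro v rfl
        exact ⟨1 - p.2, p.2, by linarith [ht.2], ht.1, by ring, by ext <;> simp [← add_mul]⟩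
      rcases hm.1 with h | h
      · exact Set.mem_biUnion (Set.mem_insert _ _) (hseg _ h)
      · exact Set.mem_biUnion (Set.mem_insert_of_mem _ rfl) (hseg _ h)

theorem isCobordism_cylinder : (cylinder G).IsCobordism G G :=
  ⟨isOriented_cylinder, carrier_cylinder_subset_slab,
    ⟨1, one_pos, fun _ _ => Iff.rfl, fun _ _ => Iff.rfl⟩,
    ⟨1, one_pos, fun _ _ => Iff.rfl, fun _ _ => Iff.rfl⟩⟩

theorem _root_.height_eq_of_mem_convexHull {τ : Fin 3 → R5} {c : ℝ} (hc : ∀ i, (τ i).2 = c) {p : R5}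
    (hp : p ∈ convexHull ℝ (Set.range τ)) : p.2 = c := by
  have h : ∀ i, τ i ∈ {p : R5 | c ≤ p.2 ∧ p.2 ≤ c} := fun i => ⟨(hc i).ge, (hc i).le⟩
  have := convexHull_min (Set.range_subset_iff.2 h) (convex_height_Icc c c) hp
  exact le_antisymm this.2 this.1

/-- The slices of a cylinder contain no triangles. -/
theorem not_subset_cylinder_slice {τ : Fin 3 → R5} (hτ : AffineIndependent ℝ τ) {c : ℝ}
    (hc : ∀ i, (τ i).2 = c) : ¬ convexHull ℝ (Set.range τ) ⊆ (cylinder G).carrier := by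
  intro hsub
  refine hτ.not_subset_segments ((G.edges.finite_toSet.image fun e => ((e.1, c), (e.2, c))).union
    (G.verts.finite_toSet.image fun v => ((v, c), (v, c)))) fun p hp => ?_
  have hpc := height_eq_of_mem_convexHull hc hp
  have h := hsub hp
  rw [carrier_cylinder] at h
  rcases h.1 with hv | ⟨e, he, hp⟩
  · exact Set.mem_biUnion (Or.inr ⟨p.1, hv, rfl⟩) (by simp [← hpc])
  · refine Set.mem_biUnion (Or.inl ⟨e, he, rfl⟩) ?_
    rw [← hpc, ← Prod.image_mk_segment_left]
    exact ⟨p.1, hp, rfl⟩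

/-! ### Collars -/

/-- One width for both ends, below 1, with agreement restated as a `Match` so that collars can be
composed with rescalings. -/
theorem IsCobordism.exists_collar (hA : A.IsCobordism G H) : ∃ ε : ℝ, 0 < ε ∧ ε < 1 ∧
    Match A (cylinder G) 1 0 0 ε ∧ Match A (cylinder H) 1 0 (1 - ε) 1 := by
  obtain ⟨ε₁, h₁, hb⟩ := hA.bottom
  obtain ⟨ε₂, h₂, ht⟩ := hA.top
  have hm : ∀ {x : ℝ}, x = min (min ε₁ ε₂) (1 / 2) → x ≤ ε₁ ∧ x ≤ ε₂ ∧ x ≤ 1 / 2 := by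
    rintro x rfl
    exact ⟨(min_le_left _ _).trans (min_le_left _ _), (min_le_left _ _).trans (min_le_right _ _),
      min_le_right _ _⟩
  obtain ⟨h3, h4, h5⟩ := hm rfl
  refine ⟨min (min ε₁ ε₂) (1 / 2), by positivity, by linarith, ?_, ?_⟩
  · exact hb.match_id ((convex_Iic ε₁).is_linear_preimage
      (IsLinearMap.mk (f := fun p : R5 => p.2) (fun _ _ => rfl) fun _ _ => rfl))
      hA.oriented isOriented_cylinder fun p _ h => h.trans h3
  · exact ht.match_id ((convex_Ici (1 - ε₂)).is_linear_preimage
      (IsLinearMap.mk (f := fun p : R5 => p.2) (fun _ _ => rfl) fun _ _ => rfl))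
      hA.oriented isOriented_cylinder fun p h _ => by simp; linarith

theorem isCobordism_of_match (hK : A.IsOriented) (hs : A.carrier ⊆ slab) {ε : ℝ} (hε : 0 < ε)
    (hb : Match A (cylinder G) 1 0 0 ε) (ht : Match A (cylinder H) 1 0 (1 - ε) 1) :
    A.IsCobordism G H where
  oriented := hK
  subset_slab := hs
  bottom := ⟨ε, hε, hb.agreeOn ((convex_Iic ε).is_linear_preimage
      (IsLinearMap.mk (f := fun p : R5 => p.2) (fun _ _ => rfl) fun _ _ => rfl))
      hs carrier_cylinder_subset_slab fun _ h h0 _ => ⟨h0, h⟩⟩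
  top := ⟨ε, hε, ht.agreeOn ((convex_Ici (1 - ε)).is_linear_preimage
      (IsLinearMap.mk (f := fun p : R5 => p.2) (fun _ _ => rfl) fun _ _ => rfl))
      hs carrier_cylinder_subset_slab fun _ h _ h1 => ⟨h, h1⟩⟩

theorem IsCobordism.height_mem (hA : A.IsCobordism G H) {p : R5} (hp : p ∈ A.carrier) :
    0 ≤ p.2 ∧ p.2 ≤ 1 :=
  (hA.subset_slab hp).2

/-- The ends of a cobordism contain no triangles. -/
theorem IsCobordism.not_subset_ends (hA : A.IsCobordism G H) {τ : Fin 3 → R5}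
    (hτ : AffineIndependent ℝ τ) (hc : (∀ i, (τ i).2 = 0) ∨ ∀ i, (τ i).2 = 1) :
    ¬ convexHull ℝ (Set.range τ) ⊆ A.carrier := by
  intro hsub
  obtain ⟨ε, h0, h1, hb, ht⟩ := hA.exists_collar
  rcases hc with hc | hc
  · refine not_subset_cylinder_slice (G := G) hτ hc fun p hp => ?_
    have := height_eq_of_mem_convexHull hc hp
    have h := (hb.carrier p this.ge (by linarith)).1 (hsub hp)
    rwa [vert_one_zero] at h
  · refine not_subset_cylinder_slice (G := H) hτ hc fun p hp => ?_
    have := height_eq_of_mem_convexHull hc hp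
    have h := (ht.carrier p (by linarith) this.le).1 (hsub hp)
    rwa [vert_one_zero] at h

theorem IsCobordism.mem_top_iff (hA : A.IsCobordism G H) {p : R5} (hp : p.2 = 1) :
    p ∈ A.carrier ↔ p ∈ (cylinder H).carrier := by
  obtain ⟨ε, h0, h1, hb, ht⟩ := hA.exists_collar
  rw [ht.carrier p (by linarith) hp.le, vert_one_zero, id]

theorem IsCobordism.mem_bottom_iff (hA : A.IsCobordism G H) {p : R5} (hp : p.2 = 0) :
    p ∈ A.carrier ↔ p ∈ (cylinder G).carrier := by
  obtain ⟨ε, h0, h1, hb, ht⟩ := hA.exists_collar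
  rw [hb.carrier p hp.ge (by linarith), vert_one_zero, id]

/-! ### Gluing -/

theorem carrier_glue : (A.glue B).carrier = vert (1 / 2) 0 '' A.carrier ∪
    vert (1 / 2) (1 / 2) '' B.carrier := by
  have hc : ∀ (a b : ℝ) (σ : Fin 3 → R5), convexHull ℝ (Set.range (vert a b ∘ σ)) =
      vert a b '' convexHull ℝ (Set.range σ) := by
    intro a b σ
    rw [← coe_vertAffine, AffineMap.image_convexHull, Set.range_comp]
  have hw : ∀ (a b : ℝ) (w : R5 × R5), segment ℝ (vert a b w.1) (vert a b w.2) =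
      vert a b '' segment ℝ w.1 w.2 := by
    intro a b w
    rw [← coe_vertAffine, image_segment]
  simp only [carrier, glue, lowerHalf_eq_vert, upperHalf_eq_vert, Set.biUnion_union,
    Set.biUnion_image, Prod.map, hc, hw, Set.image_union, Set.image_iUnion₂]
  ac_rfl

/-- A triangle cannot lie in both halves. -/
theorem not_neg_glue_of_lower (hB : B.IsCobordism H I) {ρ : Fin 3 → R5}
    (hρ : ∀ i, (ρ i).2 ≤ 1 / 2) {σ : Fin 3 → R5} (hσ : σ ∈ B.cells) :
    ¬ IsPosSub ρ (vert (1 / 2) (1 / 2) ∘ σ) := by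
  intro h
  obtain ⟨ρ, h', rfl⟩ := h.exists_of_vert
  have hsub := h'.convexHull_subset.trans (convexHull_subset_carrier hσ)
  -- Heights at most 1/2 in the upper copy force the triangle into the bottom end of `B`, which is
  -- one-dimensional.
  refine hB.not_subset_ends (h'.affineIndependent_iff.2 (hB.oriented.nondegenerate σ hσ))
    (Or.inl fun i => ?_) hsub
  have h1 := (hB.height_mem (hsub (subset_convexHull ℝ _ ⟨i, rfl⟩))).1
  have h2 := hρ i
  simp only [Function.comp, vert] at h2
  linarith

theorem not_neg_glue_of_upper (hA : A.IsCobordism G H) {ρ : Fin 3 → R5}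
    (hρ : ∀ i, 1 / 2 ≤ (ρ i).2) {σ : Fin 3 → R5} (hσ : σ ∈ A.cells) :
    ¬ IsPosSub ρ (vert (1 / 2) 0 ∘ σ) := by
  intro h
  obtain ⟨ρ, h', rfl⟩ := h.exists_of_vert
  have hsub := h'.convexHull_subset.trans (convexHull_subset_carrier hσ)
  refine hA.not_subset_ends (h'.affineIndependent_iff.2 (hA.oriented.nondegenerate σ hσ))
    (Or.inr fun i => ?_) hsub
  have h1 := (hA.height_mem (hsub (subset_convexHull ℝ _ ⟨i, rfl⟩))).2
  have h2 := hρ i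
  simp only [Function.comp, vert] at h2
  linarith

theorem neg_glue_iff {ρ : Fin 3 → R5} : (A.glue B).Neg ρ ↔
    (∃ σ ∈ A.cells, IsPosSub (flipTriangle ρ) (vert (1 / 2) 0 ∘ σ)) ∨
      ∃ σ ∈ B.cells, IsPosSub (flipTriangle ρ) (vert (1 / 2) (1 / 2) ∘ σ) := by
  simp only [Neg, glue, lowerHalf_eq_vert, upperHalf_eq_vert, Set.mem_union, Set.mem_image,
    or_and_right, exists_or, exists_exists_and_eq_and]

/-- The upper copy can interfere only at height 1/2. There its points lie on the common graph, which
is also the top end of `A`, and it contributes no nondegenerate triangle. -/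
theorem match_glue_lower (hA : A.IsCobordism G H) (hB : B.IsCobordism H I) :
    Match A (A.glue B) (1 / 2) 0 0 1 := by
  have hinj := vert_injective (show (1 / 2 : ℝ) ≠ 0 by norm_num)
  refine ⟨fun p h0 h1 => ?_, fun τ hτ => ?_⟩
  · rw [carrier_glue, Set.mem_union, (hinj 0).mem_set_image]
    refine ⟨Or.inl, fun h => h.elim id ?_⟩
    rintro ⟨q, hq, he⟩
    have h2 := congrArg Prod.snd he
    simp only [vert] at h2
    have h3 := hB.height_mem hq
    have hp1 : p.2 = 1 := by linarith
    have hq0 : q.2 = 0 := by linarith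
    rw [hA.mem_top_iff hp1]
    rw [hB.mem_bottom_iff hq0, carrier_cylinder] at hq
    rw [carrier_cylinder]
    exact ⟨(show q.1 = p.1 from (Prod.ext_iff.1 he).1) ▸ hq.1, h0, h1⟩
  · constructor
    · rintro ⟨ρ, h1, σ, hσ, h2⟩
      exact ⟨_, h1.vert _ _, neg_glue_iff.2 (Or.inl ⟨σ, hσ, h2.vert _ _⟩)⟩
    · rintro ⟨ρ, h1, h2⟩
      obtain ⟨ρ, h3, rfl⟩ := h1.exists_of_vert
      rcases neg_glue_iff.1 h2 with ⟨σ, hσ, h2⟩ | ⟨σ, hσ, h2⟩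
      · exact ⟨ρ, h3, σ, hσ, (isPosSub_vert_iff (by norm_num) _).1 h2⟩
      · refine absurd h2 (not_neg_glue_of_lower hB (fun i => ?_) hσ)
        have := (h3.mem_of_convex (convex_height_Icc 0 1) hτ (Equiv.swap 0 1 i)).2
        simp only [flipTriangle, Function.comp, vert]
        linarith

theorem match_glue_upper (hA : A.IsCobordism G H) (hB : B.IsCobordism H I) :
    Match B (A.glue B) (1 / 2) (1 / 2) 0 1 := by
  have hinj := vert_injective (show (1 / 2 : ℝ) ≠ 0 by norm_num)
  refine ⟨fun p h0 h1 => ?_, fun τ hτ => ?_⟩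
  · rw [carrier_glue, Set.mem_union, (hinj (1 / 2)).mem_set_image]
    refine ⟨Or.inr, fun h => h.elim ?_ id⟩
    rintro ⟨q, hq, he⟩
    have h2 := congrArg Prod.snd he
    simp only [vert] at h2
    have h3 := hA.height_mem hq
    have hp0 : p.2 = 0 := by linarith
    have hq1 : q.2 = 1 := by linarith
    rw [hB.mem_bottom_iff hp0]
    rw [hA.mem_top_iff hq1, carrier_cylinder] at hq
    rw [carrier_cylinder]
    exact ⟨(show q.1 = p.1 from (Prod.ext_iff.1 he).1) ▸ hq.1, h0, h1⟩
  · constructor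
    · rintro ⟨ρ, h1, σ, hσ, h2⟩
      exact ⟨_, h1.vert _ _, neg_glue_iff.2 (Or.inr ⟨σ, hσ, h2.vert _ _⟩)⟩
    · rintro ⟨ρ, h1, h2⟩
      obtain ⟨ρ, h3, rfl⟩ := h1.exists_of_vert
      rcases neg_glue_iff.1 h2 with ⟨σ, hσ, h2⟩ | ⟨σ, hσ, h2⟩
      · refine absurd h2 (not_neg_glue_of_upper hA (fun i => ?_) hσ)
        have := (h3.mem_of_convex (convex_height_Icc 0 1) hτ (Equiv.swap 0 1 i)).1
        simp only [flipTriangle, Function.comp, vert]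
        linarith
      · exact ⟨ρ, h3, σ, hσ, (isPosSub_vert_iff (by norm_num) _).1 h2⟩

theorem isOriented_glue (hA : A.IsCobordism G H) (hB : B.IsCobordism H I) :
    (A.glue B).IsOriented where
  cells_finite := (hA.oriented.cells_finite.image _).union (hB.oriented.cells_finite.image _)
  wires_finite := (hA.oriented.wires_finite.image _).union (hB.oriented.wires_finite.image _)
  nondegenerate := by
    simp only [glue, lowerHalf_eq_vert, upperHalf_eq_vert]
    rintro _ (⟨σ, hσ, rfl⟩ | ⟨σ, hσ, rfl⟩)
    exacts [(hA.oriented.nondegenerate σ hσ).vert (by norm_num) _,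
      (hB.oriented.nondegenerate σ hσ).vert (by norm_num) _]
  consistent := by
    simp only [glue, lowerHalf_eq_vert, upperHalf_eq_vert]
    have hlow : ∀ σ ∈ A.cells, ∀ ρ, IsPosSub ρ (vert (1 / 2) 0 ∘ σ) → ∀ i, (ρ i).2 ≤ 1 / 2 := by
      intro σ hσ ρ h i
      obtain ⟨ρ, h', rfl⟩ := h.exists_of_vert
      have := (hA.height_mem (convexHull_subset_carrier hσ (h'.vertex_mem i))).2
      simp only [Function.comp, vert]
      linarith
    rintro _ (⟨σ, hσ, rfl⟩ | ⟨σ, hσ, rfl⟩) _ (⟨τ, hτ, rfl⟩ | ⟨τ, hτ, rfl⟩) ρ h1 h2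
    · obtain ⟨ρ, h3, rfl⟩ := h1.exists_of_vert
      exact hA.oriented.consistent σ hσ τ hτ ρ h3 ((isPosSub_vert_iff (by norm_num) _).1 h2)
    · exact not_neg_glue_of_lower hB (fun i => hlow σ hσ ρ h1 _) hτ h2
    · refine not_neg_glue_of_lower hB (fun i => ?_) hσ h1
      have := hlow τ hτ _ h2 (Equiv.swap 0 1 i)
      simpa [flipTriangle] using this
    · obtain ⟨ρ, h3, rfl⟩ := h1.exists_of_vert
      exact hB.oriented.consistent σ hσ τ hτ ρ h3 ((isPosSub_vert_iff (by norm_num) _).1 h2)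

theorem carrier_glue_subset_slab (hA : A.IsCobordism G H) (hB : B.IsCobordism H I) :
    (A.glue B).carrier ⊆ slab := by
  rw [carrier_glue]
  rintro _ (⟨p, hp, rfl⟩ | ⟨p, hp, rfl⟩)
  · obtain ⟨h, h0, h1⟩ := hA.subset_slab hp
    refine ⟨h, ?_, ?_⟩ <;> simp only [vert] <;> linarith
  · obtain ⟨h, h0, h1⟩ := hB.subset_slab hp
    refine ⟨h, ?_, ?_⟩ <;> simp only [vert] <;> linarith

/-- Near an end the glued complex is a collar compressed by 1/2, that is, a compressed cylinder; by
`match_cylinder` this is again a cylinder, of half the width. -/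
theorem IsCobordism.glue (hA : A.IsCobordism G H) (hB : B.IsCobordism H I) :
    (A.glue B).IsCobordism G I := by
  obtain ⟨ε₁, h0, h1, hb, -⟩ := hA.exists_collar
  obtain ⟨ε₂, h0', h1', -, ht⟩ := hB.exists_collar
  have m1 := (((match_glue_lower hA hB).symm (by norm_num)).mono (c' := 0) (d' := ε₁ / 2)
    (by norm_num) (by linarith)).trans (by norm_num) hb (by norm_num) (by linarith)
  have m2 := (((match_glue_upper hA hB).symm (by norm_num)).mono (c' := 1 - ε₂ / 2) (d' := 1)
    (by linarith) (by norm_num)).trans (by norm_num) ht (by norm_num; linarith) (by norm_num)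
  have m1' := m1.trans (by norm_num) (match_cylinder (a := 1 / 2) (b := 0) (c := 0) (d := ε₁)
    (by norm_num) le_rfl h1.le (by norm_num) (by linarith)) (by norm_num) (by linarith)
  have m2' := m2.trans (by norm_num) (match_cylinder (a := 1 / 2) (b := 1 / 2) (c := 1 - ε₂) (d := 1)
    (by norm_num) (by linarith) le_rfl (by linarith) (by linarith)) (by norm_num; linarith) (by norm_num)
  norm_num at m1' m2'
  refine isCobordism_of_match (isOriented_glue hA hB) (carrier_glue_subset_slab hA hB)
    (ε := min (ε₁ / 2) (ε₂ / 2)) (by positivity) (m1'.mono le_rfl (min_le_left _ _))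
    (m2'.mono ?_ le_rfl)
  linarith [min_le_right (ε₁ / 2) (ε₂ / 2)]

end TwoComplex

/-! ### Polyhedra -/

section Polyhedra

variable {E F : Type*} [AddCommGroup E] [Module ℝ E] [AddCommGroup F] [Module ℝ F]

open Classical in
theorem isPolyhedron_iUnion {ι : Type*} [Fintype ι] {X : ι → Set E} (h : ∀ i, IsPolyhedron (X i)) :
    IsPolyhedron (⋃ i, X i) := by
  choose P hP using h
  refine ⟨Finset.univ.biUnion P, ?_⟩
  ext x
  simp only [hP, Set.mem_iUnion, Finset.mem_biUnion, Finset.mem_univ, true_and, exists_prop]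
  tauto

theorem IsPolyhedron.union {X Y : Set E} (hX : IsPolyhedron X) (hY : IsPolyhedron Y) :
    IsPolyhedron (X ∪ Y) := by
  rw [Set.union_eq_iUnion]
  exact isPolyhedron_iUnion fun b => by cases b <;> assumption

theorem isPolyhedron_convexHull {s : Set E} (hs : s.Finite) : IsPolyhedron (convexHull ℝ s) :=
  ⟨{hs.toFinset}, by simp⟩

theorem IsPolyhedron.exists_iUnion {X : Set E} (h : IsPolyhedron X) :
    ∃ P : Finset (Finset E), X = ⋃ s : P, convexHull ℝ ((s : Finset E) : Set E) := by
  obtain ⟨P, rfl⟩ := h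
  exact ⟨P, by simp [Set.iUnion_subtype]⟩

theorem IsPolyhedron.image {X : Set E} (h : IsPolyhedron X) (f : E →ᵃ[ℝ] F) :
    IsPolyhedron (f '' X) := by
  obtain ⟨P, rfl⟩ := h.exists_iUnion
  rw [Set.image_iUnion]
  refine isPolyhedron_iUnion fun s => ?_
  rw [AffineMap.image_convexHull]
  exact isPolyhedron_convexHull (s.1.finite_toSet.image f)

theorem IsPolyhedron.prod {X : Set E} {Y : Set F} (hX : IsPolyhedron X) (hY : IsPolyhedron Y) :
    IsPolyhedron (X ×ˢ Y) := by
  obtain ⟨P, rfl⟩ := hX.exists_iUnion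
  obtain ⟨Q, rfl⟩ := hY.exists_iUnion
  rw [Set.prod_iUnion]
  refine isPolyhedron_iUnion fun t => ?_
  rw [Set.iUnion_prod_const]
  refine isPolyhedron_iUnion fun s => ?_
  rw [← convexHull_prod]
  exact isPolyhedron_convexHull (Set.Finite.prod (Finset.finite_toSet _) (Finset.finite_toSet _))

/-- The reweighting that moves a convex combination off the points where `g` is positive. -/
theorem sum_reweight {ι : Type*} (P N : Finset ι) (w g : ι → ℝ) (φ : ι → F) {ν : ℝ}
    (hν : ∑ p ∈ P, w p * -g p = ν) (h0 : ν ≠ 0) :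
    ∑ p ∈ P, (w p * (1 - (∑ n ∈ N, w n * g n) / ν)) • φ p +
      ∑ q ∈ P ×ˢ N, (w q.1 * w q.2 / ν) • (g q.2 • φ q.1 - g q.1 • φ q.2) =
      ∑ p ∈ P, w p • φ p + ∑ n ∈ N, w n • φ n := by
  have h1 : ∑ q ∈ P ×ˢ N, (w q.1 * w q.2 / ν) • g q.2 • φ q.1 =
      ∑ p ∈ P, (w p * ((∑ n ∈ N, w n * g n) / ν)) • φ p := by
    rw [Finset.sum_product]
    refine Finset.sum_congr rfl fun p _ => ?_
    rw [Finset.sum_div, Finset.mul_sum, Finset.sum_smul]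
    exact Finset.sum_congr rfl fun n _ => by rw [smul_smul]; congr 1; ring
  have h2 : ∑ q ∈ P ×ˢ N, (w q.1 * w q.2 / ν) • g q.1 • φ q.2 = -∑ n ∈ N, w n • φ n := by
    rw [Finset.sum_product_right, ← Finset.sum_neg_distrib]
    refine Finset.sum_congr rfl fun n _ => ?_
    simp only [smul_smul]
    rw [← Finset.sum_smul, ← neg_smul]
    congr 1
    calc _ = ∑ p ∈ P, (w p * -g p) * (-(w n / ν)) := Finset.sum_congr rfl fun p _ => by ring
      _ = _ := by rw [← Finset.sum_mul, hν]; field_simp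
  simp only [smul_sub, Finset.sum_sub_distrib, h1, h2, mul_sub, mul_one, sub_smul]
  abel

open Classical in
-- The truncated polytope is spanned by the vertices in the half-space and by the points `z` where
-- segments from these to the other vertices cross the bounding hyperplane. `sum_reweight` rewrites
-- a convex combination accordingly: each pair receives a multiple of its crossing point, and the
-- outer vertices disappear.
theorem isPolyhedron_convexHull_inter_halfSpace (s : Finset E) (f : E →ₗ[ℝ] ℝ) (c : ℝ) :
    IsPolyhedron (convexHull ℝ (s : Set E) ∩ {x | f x ≤ c}) := by
  set g : E → ℝ := fun x => f x - c with hg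
  set P := s.filter fun v => g v ≤ 0 with hP
  set N := s.filter fun v => ¬ g v ≤ 0 with hN
  let z : E × E → E := fun q => (g q.2 - g q.1)⁻¹ • (g q.2 • q.1 - g q.1 • q.2)
  set T : Finset E := P ∪ (P ×ˢ N).image z with hT
  have hPN : ∀ q ∈ P ×ˢ N, g q.1 ≤ 0 ∧ 0 < g q.2 ∧ 0 < g q.2 - g q.1 := by
    intro q hq
    simp only [hP, hN, Finset.mem_product, Finset.mem_filter, not_le] at hq
    exact ⟨hq.1.2, hq.2.2, by linarith [hq.1.2, hq.2.2]⟩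
  suffices h : convexHull ℝ (s : Set E) ∩ {x | f x ≤ c} = convexHull ℝ (T : Set E) by
    rw [h]; exact isPolyhedron_convexHull T.finite_toSet
  apply Set.Subset.antisymm
  · rintro x ⟨hx, hfx⟩
    obtain ⟨w, w0, w1, rfl⟩ := Finset.mem_convexHull'.1 hx
    have hsplit : ∀ φ : E → ℝ, ∑ p ∈ P, w p • φ p + ∑ n ∈ N, w n • φ n = ∑ v ∈ s, w v • φ v :=
      fun φ => Finset.sum_filter_add_sum_filter_not s _ _
    have hsplit' : ∑ p ∈ P, w p • p + ∑ n ∈ N, w n • n = ∑ v ∈ s, w v • v :=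
      Finset.sum_filter_add_sum_filter_not s _ _
    have hle : ∑ p ∈ P, w p * g p + ∑ n ∈ N, w n * g n ≤ 0 := by
      have h1 := hsplit g
      simp only [smul_eq_mul] at h1
      rw [h1]
      simp only [hg, mul_sub, Finset.sum_sub_distrib, ← Finset.sum_mul, w1]
      simp only [Set.mem_ofPred_eq, map_sum, map_smul, smul_eq_mul] at hfx
      linarith
    have hpos : 0 ≤ ∑ n ∈ N, w n * g n := Finset.sum_nonneg fun n hn => by
      simp only [hN, Finset.mem_filter, not_le] at hn
      exact mul_nonneg (w0 n hn.1) hn.2.le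
    set ν := ∑ p ∈ P, w p * -g p with hν
    have hν' : ∑ p ∈ P, w p * g p = -ν := by simp [hν]
    -- If `ν` vanishes, the reweighting would divide by zero, but then all weights on outer vertices
    -- are already zero.
    rcases eq_or_ne ν 0 with h0 | h0
    · have hz : ∑ n ∈ N, w n * g n = 0 := by linarith
      have hw : ∀ n ∈ N, w n = 0 := by
        intro n hn
        have h2 := (Finset.sum_eq_zero_iff_of_nonneg fun n hn => by
          simp only [hN, Finset.mem_filter, not_le] at hn
          exact mul_nonneg (w0 n hn.1) hn.2.le).1 hz n hn
        simp only [hN, Finset.mem_filter, not_le] at hn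
        exact (mul_eq_zero.1 h2).resolve_right hn.2.ne'
      have h1 := hsplit fun _ => (1 : ℝ)
      rw [Finset.sum_eq_zero (s := N) fun n hn => by rw [hw n hn, zero_smul], add_zero] at h1
      rw [Finset.sum_eq_zero (s := N) fun n hn => by rw [hw n hn, zero_smul], add_zero] at hsplit'
      simp only [smul_eq_mul, mul_one, w1] at h1
      rw [← hsplit']
      exact (convex_convexHull ℝ _).sum_mem (fun p hp => w0 p (Finset.mem_filter.1 hp).1) h1
        fun p hp => subset_convexHull ℝ _ (Finset.mem_union_left _ hp)
    · have hν0 : 0 < ν := lt_of_le_of_ne (by linarith) h0.symm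
      have hr : (∑ n ∈ N, w n * g n) / ν ≤ 1 := (div_le_one hν0).2 (by linarith)
      have key := sum_reweight P N w g id hν.symm h0
      have key1 := sum_reweight P N w g (fun _ => (1 : ℝ)) hν.symm h0
      rw [hsplit] at key1
      simp only [id] at key
      rw [hsplit'] at key
      simp only [smul_eq_mul, mul_one, w1] at key1
      rw [← key]
      have hterm : ∑ q ∈ P ×ˢ N, (w q.1 * w q.2 / ν) • (g q.2 • q.1 - g q.1 • q.2) =
          ∑ q ∈ P ×ˢ N, (w q.1 * w q.2 / ν * (g q.2 - g q.1)) • z q :=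
        Finset.sum_congr rfl fun q hq => by
          rw [mul_smul, smul_inv_smul₀ (hPN q hq).2.2.ne']
      have hform : ∑ p ∈ P, (w p * (1 - (∑ n ∈ N, w n * g n) / ν)) • p +
          ∑ q ∈ P ×ˢ N, (w q.1 * w q.2 / ν * (g q.2 - g q.1)) • z q =
          ∑ q ∈ P.disjSum (P ×ˢ N), (Sum.elim (fun p => w p * (1 - (∑ n ∈ N, w n * g n) / ν))
            (fun q => w q.1 * w q.2 / ν * (g q.2 - g q.1)) q) • Sum.elim id z q := by
        rw [Finset.sum_disjSum]; rfl
      rw [hterm, hform]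
      refine (convex_convexHull ℝ _).sum_mem ?_ ?_ ?_
      · rintro (p | q) hq
        · rw [Finset.inl_mem_disjSum] at hq
          exact mul_nonneg (w0 p (Finset.mem_filter.1 hq).1) (by linarith)
        · rw [Finset.inr_mem_disjSum] at hq
          have h1 := w0 q.1 (Finset.mem_filter.1 (Finset.mem_product.1 hq).1).1
          have h2 := w0 q.2 (Finset.mem_filter.1 (Finset.mem_product.1 hq).2).1
          have h3 := (hPN q hq).2.2
          simp only [Sum.elim_inr]
          positivity
      · rw [Finset.sum_disjSum]
        exact key1
      · rintro (p | q) hq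
        · rw [Finset.inl_mem_disjSum] at hq
          exact subset_convexHull ℝ _ (Finset.mem_union_left _ hq)
        · rw [Finset.inr_mem_disjSum] at hq
          exact subset_convexHull ℝ _ (Finset.mem_union_right _ (Finset.mem_image_of_mem z hq))
  · refine convexHull_min ?_ ((convex_convexHull ℝ _).inter
      (convex_halfSpace_le f.isLinear c))
    intro x hx
    rcases Finset.mem_union.1 (Finset.mem_coe.1 hx) with h | h
    · obtain ⟨h1, h2⟩ := Finset.mem_filter.1 h
      exact ⟨subset_convexHull ℝ _ h1, sub_nonpos.1 h2⟩
    · obtain ⟨q, hq, rfl⟩ := Finset.mem_image.1 h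
      obtain ⟨h1, h2, h3⟩ := hPN q hq
      obtain ⟨hq1, hq2⟩ := Finset.mem_product.1 hq
      constructor
      · have hz : z q = (g q.2 / (g q.2 - g q.1)) • q.1 + (-g q.1 / (g q.2 - g q.1)) • q.2 := by
          simp only [z, smul_sub, smul_smul, div_eq_inv_mul, mul_neg, neg_smul]
          abel
        rw [hz]
        refine (convex_convexHull ℝ _) (subset_convexHull ℝ _ (Finset.mem_filter.1 hq1).1)
          (subset_convexHull ℝ _ (Finset.mem_filter.1 hq2).1) (by positivity)
          (div_nonneg (by linarith) h3.le) ?_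
        rw [← add_div, ← sub_eq_add_neg, div_self h3.ne']
      · have hz : f (z q) = (g q.2 - g q.1)⁻¹ * ((g q.2 - g q.1) * c) := by
          simp only [z, map_smul, map_sub, smul_eq_mul, hg]; ring
        rw [Set.mem_ofPred_eq, hz, inv_mul_cancel_left₀ h3.ne']

theorem IsPolyhedron.inter_halfSpace {X : Set E} (h : IsPolyhedron X) (f : E →ₗ[ℝ] ℝ) (c : ℝ) :
    IsPolyhedron (X ∩ {x | f x ≤ c}) := by
  obtain ⟨P, rfl⟩ := h.exists_iUnion
  rw [Set.iUnion_inter]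
  exact isPolyhedron_iUnion fun s => isPolyhedron_convexHull_inter_halfSpace s.1 f c

theorem isPolyhedron_Icc {a b : ℝ} (h : a ≤ b) : IsPolyhedron (Set.Icc a b) := by
  rw [← segment_eq_Icc h, ← convexHull_pair]
  exact isPolyhedron_convexHull (Set.toFinite _)

theorem isPolyhedron_S3 : IsPolyhedron S3 := by
  have hcube : IsPolyhedron (Set.univ.pi fun _ : Fin 4 => Set.Icc (-1 : ℝ) 1) := by
    have : (Set.univ.pi fun _ : Fin 4 => Set.Icc (-1 : ℝ) 1) =
        convexHull ℝ (Set.univ.pi fun _ : Fin 4 => {-1, 1}) := by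
      rw [convexHull_pi, convexHull_pair, segment_eq_Icc (by norm_num)]
    rw [this]
    exact isPolyhedron_convexHull (Set.Finite.pi fun _ => Set.toFinite _)
  have h : S3 = ⋃ i : Fin 4,
      (((Set.univ.pi fun _ : Fin 4 => Set.Icc (-1 : ℝ) 1) ∩ {x | LinearMap.proj (R := ℝ) i x ≤ -1}) ∪
      ((Set.univ.pi fun _ : Fin 4 => Set.Icc (-1 : ℝ) 1) ∩
        {x | (-LinearMap.proj (R := ℝ) (φ := fun _ : Fin 4 => ℝ) i) x ≤ -1})) := by
    ext x
    simp only [S3, mem_sphere_zero_iff_norm, Set.mem_iUnion, ← Set.inter_union_distrib_left,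
      Set.mem_inter_iff, Set.mem_univ_pi, Set.mem_union, Set.mem_ofPred_eq, LinearMap.neg_apply,
      LinearMap.proj_apply, neg_le_neg_iff, exists_and_left, Set.mem_Icc, ← abs_le]
    have h1 : (∀ i, |x i| ≤ 1) ↔ ‖x‖ ≤ 1 := by
      simp only [pi_norm_le_iff_of_nonneg zero_le_one, Real.norm_eq_abs]
    have h2 : (∃ i, x i ≤ -1 ∨ 1 ≤ x i) ↔ 1 ≤ ‖x‖ := by
      rw [← not_lt, pi_norm_lt_iff one_pos]
      push Not
      exact exists_congr fun i => by rw [Real.norm_eq_abs, le_abs', or_comm.symm.trans or_comm]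
    rw [h1, h2, le_antisymm_iff]
  rw [h]
  exact isPolyhedron_iUnion fun i => (hcube.inter_halfSpace _ _).union (hcube.inter_halfSpace _ _)

end Polyhedra

open TwoComplex

theorem convexHull_range_comp_vert (a b : ℝ) (σ : Fin 3 → R5) :
    convexHull ℝ (Set.range (vert a b ∘ σ)) = vert a b '' convexHull ℝ (Set.range σ) := by
  rw [← coe_vertAffine, AffineMap.image_convexHull, Set.range_comp]

/-! ### Maps that carry one oriented polyhedron to another -/

/-- `F` carries the part of `K` at the heights in `[c, d]` to `L`, preserving orientations. -/
structure Carries (F : R5 → R5) (K L : TwoComplex) (c d : ℝ) : Prop where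
  carrier : ∀ p ∈ slab, c ≤ p.2 → p.2 ≤ d → (p ∈ K.carrier ↔ F p ∈ L.carrier)
  negIn : ∀ τ : Fin 3 → R5, convexHull ℝ (Set.range τ) ⊆ slab →
    (∃ f : R5 →ᵃ[ℝ] R5, Set.EqOn F f (convexHull ℝ (Set.range τ))) →
    (∀ i, c ≤ (τ i).2 ∧ (τ i).2 ≤ d) → (K.NegIn τ ↔ L.NegIn (F ∘ τ))

namespace Carries

variable {F : R5 → R5} {K L : TwoComplex} {c d e : ℝ}

theorem join (h : Carries F K L c d) (h' : Carries F K L d e) : Carries F K L c e := by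
  refine ⟨fun p hp h1 h2 => ?_, fun τ hs ⟨f, hf⟩ hτ => ?_⟩
  · rcases le_total p.2 d with hd | hd
    exacts [h.carrier p hp h1 hd, h'.carrier p hp hd h2]
  have key : ∀ ρ, IsPosSub ρ τ → ((∀ i, (ρ i).2 ≤ d) ∨ ∀ i, d ≤ (ρ i).2) →
      (K.NegIn ρ ↔ L.NegIn (F ∘ ρ)) := by
    intro ρ h1 h3
    have hρ := h1.mem_of_convex (convex_height_Icc c e) hτ
    have hρs := h1.convexHull_subset
    rcases h3 with h3 | h3
    · exact h.negIn ρ (hρs.trans hs) ⟨f, hf.mono hρs⟩ fun i => ⟨(hρ i).1, h3 i⟩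
    · exact h'.negIn ρ (hρs.trans hs) ⟨f, hf.mono hρs⟩ fun i => ⟨h3 i, (hρ i).2⟩
  constructor
  · intro hn
    obtain ⟨ρ, h1, h2, h3⟩ := hn.exists_height d
    exact ((key ρ h1 h3).1 h2.negIn).of_sub (h1.image hf)
  · rintro ⟨ρ, h1, h2⟩
    obtain ⟨ρ, h4, rfl⟩ := IsPosSub.exists_of_image hf h1
    -- The cut is made in the source, since `F` need not carry levels to levels.
    obtain ⟨ρ', h5, h6⟩ := IsPosSub.exists_height ρ d
    have h7 := h5.image (hf.mono h4.convexHull_subset)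
    exact ((key ρ' (h5.trans h4) h6).2 (h2.of_sub h7).negIn).of_sub (h5.trans h4)

theorem of_match {a b : ℝ} (h : Match K L a b c d)
    (hF : ∀ p ∈ slab, c ≤ p.2 → p.2 ≤ d → F p = vert a b p) : Carries F K L c d := by
  refine ⟨fun p hp h1 h2 => by rw [h.carrier p h1 h2, hF p hp h1 h2], fun τ hs _ hτ => ?_⟩
  have : F ∘ τ = vert a b ∘ τ := funext fun i =>
    hF (τ i) (hs (subset_convexHull ℝ _ ⟨i, rfl⟩)) (hτ i).1 (hτ i).2
  rw [h.negIn τ hτ, this]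

/-- Transports a comparison of two cobordisms to their rescaled copies inside a glued complex. -/
theorem conj {F₀ : R5 → R5} {A B : TwoComplex} {a b : ℝ} (ha : 0 < a) (h : Carries F₀ A B 0 1)
    (hA : Match A K a b 0 1) (hB : Match B L a b 0 1) (hm : Set.MapsTo F₀ slab slab)
    (hF : ∀ p ∈ slab, F (vert a b p) = vert a b (F₀ p)) : Carries F K L b (a + b) := by
  have hinv : ∀ p, vert a b (vert a⁻¹ (-(a⁻¹ * b)) p) = p := congrFun (vert_comp_inv ha.ne' b)
  have hinv' : ∀ p, vert a⁻¹ (-(a⁻¹ * b)) (vert a b p) = p := congrFun (vert_inv_comp ha.ne' b)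
  have hslab : ∀ p : R5, p.1 ∈ S3 → b ≤ p.2 → p.2 ≤ a + b →
      vert a⁻¹ (-(a⁻¹ * b)) p ∈ slab := by
    intro p hp h1 h2
    have e : (vert a⁻¹ (-(a⁻¹ * b)) p).2 = (p.2 - b) / a := by
      simp only [vert]; ring
    refine ⟨hp, ?_⟩
    rw [e, Set.mem_Icc, le_div_iff₀ ha, div_le_iff₀ ha]
    constructor <;> linarith
  refine ⟨fun p hp h1 h2 => ?_, fun τ hs ⟨f, hf⟩ hτ => ?_⟩
  · have hq := hslab p hp.1 h1 h2
    have hpq := hinv p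
    generalize vert a⁻¹ (-(a⁻¹ * b)) p = q at hq hpq
    subst hpq
    rw [← hA.carrier q hq.2.1 hq.2.2, hF q hq, ← hB.carrier _ (hm hq).2.1 (hm hq).2.2,
      h.carrier q hq hq.2.1 hq.2.2]
  · have hσ : τ = vert a b ∘ (vert a⁻¹ (-(a⁻¹ * b)) ∘ τ) := by
      funext i; exact (hinv _).symm
    have hσs : convexHull ℝ (Set.range (vert a⁻¹ (-(a⁻¹ * b)) ∘ τ)) ⊆ slab := by
      rw [convexHull_range_comp_vert]
      rintro _ ⟨p, hp, rfl⟩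
      have := convexHull_min (Set.range_subset_iff.2 hτ) (convex_height_Icc b (a + b)) hp
      exact hslab p (hs hp).1 this.1 this.2
    generalize vert a⁻¹ (-(a⁻¹ * b)) ∘ τ = σ at hσ hσs
    subst hσ
    have hv : ∀ i, σ i ∈ slab := fun i => hσs (subset_convexHull ℝ _ ⟨i, rfl⟩)
    rw [← hA.negIn σ fun i => (hv i).2]
    have e : F ∘ vert a b ∘ σ = vert a b ∘ (F₀ ∘ σ) := funext fun i => hF _ (hv i)
    rw [e, ← hB.negIn (F₀ ∘ σ) fun i => (hm (hv i)).2]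
    refine h.negIn σ hσs
      ⟨(vertAffine a⁻¹ (-(a⁻¹ * b))).comp (f.comp (vertAffine a b)), fun p hp => ?_⟩ fun i => (hv i).2
    have h1 : vert a b p ∈ convexHull ℝ (Set.range (vert a b ∘ σ)) := by
      rw [convexHull_range_comp_vert]; exact ⟨p, hp, rfl⟩
    simp only [AffineMap.comp_apply, coe_vertAffine, ← hf h1, hF p (hσs hp), hinv']

end Carries

/-- Replaces preservation of positive triangles by preservation of negativity, which can be checked
piece by piece. The two agree because the end map is a bijection of the slab, so it preserves
nondegeneracy of triangles on which it is affine and matches containment in the carriers. -/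
theorem isotopic_iff {G H : KauffmanGraph} {A B : Cobordism G H} :
    Isotopic A B ↔ ∃ Φ : ℝ → R5 → R5, IsPLIsotopy Φ ∧ Carries (Φ 1) A.1 B.1 0 1 := by
  have h1 : (1 : ℝ) ∈ Set.Icc (0 : ℝ) 1 := ⟨zero_le_one, le_rfl⟩
  constructor
  · rintro ⟨Φ, hΦ, hc, ho⟩
    have hb := hΦ.bij 1 h1
    have hcar : ∀ p ∈ slab, p ∈ A.1.carrier ↔ Φ 1 p ∈ B.1.carrier := by
      intro p hp
      rw [← hc]
      refine ⟨fun h => ⟨p, h, rfl⟩, ?_⟩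
      rintro ⟨q, hq, he⟩
      rwa [← hb.injOn (A.2.subset_slab hq) hp he]
    refine ⟨Φ, hΦ, fun p hp _ _ => hcar p hp, fun τ hs ⟨f, hf⟩ _ => ⟨?_, ?_⟩⟩
    · rintro ⟨ρ, h2, h3⟩
      have hρs := h2.convexHull_subset.trans hs
      have hρf := hf.mono h2.convexHull_subset
      have h4 : ¬ B.1.Positive (Φ 1 ∘ ρ) := by
        rw [← ho ρ hρs ⟨f, hρf⟩, positive_iff]
        exact fun h => h.2.2 h3.negIn
      rw [positive_iff] at h4
      push Not at h4
      refine (h4 ((h3.affineIndependent A.2.oriented).image_triangle hρf (hb.injOn.mono hρs))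
        ?_).of_sub (h2.image hf)
      rw [Set.range_comp, hρf.mono (subset_convexHull ℝ _) |>.image_eq, ← AffineMap.image_convexHull,
        ← hρf.image_eq, ← hc]
      exact Set.image_mono h3.subset_carrier
    · rintro ⟨ρ, h2, h3⟩
      obtain ⟨ρ, h5, rfl⟩ := IsPosSub.exists_of_image hf h2
      have hρs := h5.convexHull_subset.trans hs
      have hρf := hf.mono h5.convexHull_subset
      have h4 : ¬ A.1.Positive ρ := by
        rw [ho ρ hρs ⟨f, hρf⟩, positive_iff]
        exact fun h => h.2.2 h3.negIn
      rw [positive_iff] at h4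
      push Not at h4
      refine (h4 ?_ fun p hp => ?_).of_sub h5
      · have h6 := h3.affineIndependent B.2.oriented
        have e : Φ 1 ∘ ρ = f ∘ ρ := funext fun i => hρf (subset_convexHull ℝ _ ⟨i, rfl⟩)
        rw [e] at h6
        exact AffineIndependent.of_comp f h6
      · rw [hcar p (hρs hp)]
        apply h3.subset_carrier
        rw [Set.range_comp, hρf.mono (subset_convexHull ℝ _) |>.image_eq,
          ← AffineMap.image_convexHull, ← hρf.image_eq]
        exact ⟨p, hp, rfl⟩
  · rintro ⟨Φ, hΦ, hF⟩
    have hb := hΦ.bij 1 h1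
    have hcar : ∀ p ∈ slab, p ∈ A.1.carrier ↔ Φ 1 p ∈ B.1.carrier := fun p hp =>
      hF.carrier p hp hp.2.1 hp.2.2
    refine ⟨Φ, hΦ, ?_, fun τ hs ⟨f, hf⟩ => ?_⟩
    · ext q
      constructor
      · rintro ⟨p, hp, rfl⟩
        exact (hcar p (A.2.subset_slab hp)).1 hp
      · intro hq
        obtain ⟨p, hp, rfl⟩ := hb.surjOn (B.2.subset_slab hq)
        exact ⟨p, (hcar p hp).2 hq, rfl⟩
    · have e : Φ 1 ∘ τ = f ∘ τ := funext fun i => hf (subset_convexHull ℝ _ ⟨i, rfl⟩)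
      rw [positive_iff, positive_iff, hF.negIn τ hs ⟨f, hf⟩
        fun i => (hs (subset_convexHull ℝ _ ⟨i, rfl⟩)).2]
      refine and_congr ⟨fun h => h.image_triangle hf (hb.injOn.mono hs), fun h => ?_⟩
        (and_congr_left fun _ => ?_)
      · rw [e] at h
        exact AffineIndependent.of_comp f h
      · rw [Set.range_comp, hf.mono (subset_convexHull ℝ _) |>.image_eq,
          ← AffineMap.image_convexHull, ← hf.image_eq, Set.image_subset_iff]
        exact forall₂_congr fun p hp => hcar p (hs hp)

/-! ### Isotopies -/

theorem isPolyhedron_slab : IsPolyhedron slab :=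
  isPolyhedron_S3.prod (isPolyhedron_Icc zero_le_one)

theorem isPLIsotopy_id : IsPLIsotopy fun _ p => p where
  pl := by
    convert ((isPolyhedron_Icc (zero_le_one (α := ℝ))).prod isPolyhedron_slab).image
      ((AffineMap.id ℝ (ℝ × R5)).prod AffineMap.snd) using 1
    ext ⟨⟨s, p⟩, q⟩
    simp only [Set.mem_ofPred_eq, Set.mem_image, Set.mem_prod, Prod.exists, AffineMap.prod_apply,
      AffineMap.id_apply, AffineMap.coe_snd, Prod.mk.injEq]
    constructor
    · rintro ⟨h1, h2, rfl⟩
      exact ⟨s, q.1, q.2, ⟨h1, h2⟩, ⟨rfl, rfl⟩, rfl⟩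
    · rintro ⟨s, x, t, ⟨h1, h2⟩, ⟨rfl, rfl⟩, rfl⟩
      exact ⟨h1, h2, rfl⟩
  bij _ _ := Set.bijOn_id _
  start _ _ := rfl
  rel_ends _ _ _ _ _ := rfl

theorem isotopic_refl {G H : KauffmanGraph} (A : Cobordism G H) : Isotopic A A :=
  isotopic_iff.2 ⟨_, isPLIsotopy_id, fun _ _ _ _ => Iff.rfl, fun _ _ _ _ => Iff.rfl⟩

/-- `F` in the lower half of the slab and `F'` in the upper half. -/
noncomputable def stack (F F' : R5 → R5) (p : R5) : R5 :=
  if p.2 ≤ 1 / 2 then vert (1 / 2) 0 (F (vert 2 0 p))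
  else vert (1 / 2) (1 / 2) (F' (vert 2 (-1) p))

section Stack

variable {F F' : R5 → R5}

theorem stack_lower {p : R5} (hp : p ∈ slab) :
    stack F F' (vert (1 / 2) 0 p) = vert (1 / 2) 0 (F p) := by
  have h1 : (vert (1 / 2) 0 p).2 ≤ 1 / 2 := by
    have := hp.2.2; simp only [vert]; linarith
  have h2 : vert 2 0 (vert (1 / 2) 0 p) = p := by ext <;> simp [vert]
  rw [stack, if_pos h1, h2]

theorem stack_upper (h : ∀ p ∈ slab, p.2 = 1 → F p = p) (h' : ∀ p ∈ slab, p.2 = 0 → F' p = p)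
    {p : R5} (hp : p ∈ slab) :
    stack F F' (vert (1 / 2) (1 / 2) p) = vert (1 / 2) (1 / 2) (F' p) := by
  rcases hp.2.1.eq_or_lt with h0 | h0
  · have h1 : vert (1 / 2) (1 / 2) p = vert (1 / 2) 0 (p.1, 1) := by
      simp [vert, ← h0]
    have h2 : ((p.1, 1) : R5) ∈ slab := ⟨hp.1, zero_le_one, le_rfl⟩
    rw [h1, stack_lower h2, h _ h2 rfl, h' p hp h0.symm, h1]
  · have h1 : ¬ (vert (1 / 2) (1 / 2) p).2 ≤ 1 / 2 := by
      simp only [vert]; linarith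
    have h2 : vert 2 (-1) (vert (1 / 2) (1 / 2) p) = p := by
      ext <;> simp [vert]; ring
    rw [stack, if_neg h1, h2]

theorem slab_eq_union : slab = vert (1 / 2) 0 '' slab ∪ vert (1 / 2) (1 / 2) '' slab := by
  ext p
  constructor
  · rintro ⟨h, h0, h1⟩
    rcases le_total p.2 (1 / 2) with h2 | h2
    · exact Or.inl ⟨(p.1, 2 * p.2), ⟨h, by simp; linarith, by simp; linarith⟩, by
        ext <;> simp [vert]⟩
    · exact Or.inr ⟨(p.1, 2 * p.2 - 1), ⟨h, by simp; linarith, by simp; linarith⟩, by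
        ext <;> simp [vert]; ring⟩
  · rintro (⟨q, ⟨h, h0, h1⟩, rfl⟩ | ⟨q, ⟨h, h0, h1⟩, rfl⟩)
    · exact ⟨h, by simp only [vert]; linarith, by simp only [vert]; linarith⟩
    · exact ⟨h, by simp only [vert]; linarith, by simp only [vert]; linarith⟩

/-- Points of different halves with the same image are sent to the middle level. There both maps are
the identity, so by injectivity the points were at that level already and coincide. -/
theorem bijOn_stack (hF : Set.BijOn F slab slab) (hF' : Set.BijOn F' slab slab)
    (h : ∀ p ∈ slab, p.2 = 1 → F p = p) (h' : ∀ p ∈ slab, p.2 = 0 → F' p = p) :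
    Set.BijOn (stack F F') slab slab := by
  have hinj := vert_injective (show (1 / 2 : ℝ) ≠ 0 by norm_num)
  have hcross : ∀ p ∈ slab, ∀ q ∈ slab, stack F F' (vert (1 / 2) 0 p) =
      stack F F' (vert (1 / 2) (1 / 2) q) → vert (1 / 2) 0 p = vert (1 / 2) (1 / 2) q := by
    intro p hp q hq he
    rw [stack_lower hp, stack_upper h h' hq] at he
    have h2 := congrArg Prod.snd he
    simp only [vert] at h2
    have h3 := (hF.mapsTo hp).2.2
    have h4 := (hF'.mapsTo hq).2.1
    have e1 : F p = p := hF.injOn (hF.mapsTo hp) hp (h _ (hF.mapsTo hp) (by linarith))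
    have e2 : F' q = q := hF'.injOn (hF'.mapsTo hq) hq (h' _ (hF'.mapsTo hq) (by linarith))
    rwa [e1, e2] at he
  refine ⟨fun p hp => ?_, fun p hp q hq he => ?_, fun p hp => ?_⟩
  · rw [slab_eq_union] at hp ⊢
    rcases hp with ⟨p, hp, rfl⟩ | ⟨p, hp, rfl⟩
    · exact Or.inl ⟨F p, hF.mapsTo hp, (stack_lower hp).symm⟩
    · exact Or.inr ⟨F' p, hF'.mapsTo hp, (stack_upper h h' hp).symm⟩
  · rw [slab_eq_union] at hp hq
    rcases hp with ⟨p, hp, rfl⟩ | ⟨p, hp, rfl⟩ <;> rcases hq with ⟨q, hq, rfl⟩ | ⟨q, hq, rfl⟩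
    · rw [stack_lower hp, stack_lower hq] at he
      rw [hF.injOn hp hq (hinj _ he)]
    · exact hcross p hp q hq he
    · exact (hcross q hq p hp he.symm).symm
    · rw [stack_upper h h' hp, stack_upper h h' hq] at he
      rw [hF'.injOn hp hq (hinj _ he)]
  · rw [slab_eq_union] at hp
    rcases hp with ⟨p, hp, rfl⟩ | ⟨p, hp, rfl⟩
    · obtain ⟨q, hq, rfl⟩ := hF.surjOn hp
      exact ⟨_, slab_eq_union ▸ Or.inl ⟨q, hq, rfl⟩, stack_lower hq⟩
    · obtain ⟨q, hq, rfl⟩ := hF'.surjOn hp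
      exact ⟨_, slab_eq_union ▸ Or.inr ⟨q, hq, rfl⟩, stack_upper h h' hq⟩

end Stack

theorem IsPLIsotopy.stack {Φ Φ' : ℝ → R5 → R5} (h : IsPLIsotopy Φ) (h' : IsPLIsotopy Φ') :
    IsPLIsotopy fun s => stack (Φ s) (Φ' s) := by
  have e1 : ∀ s ∈ Set.Icc (0 : ℝ) 1, ∀ p ∈ slab, p.2 = 1 → Φ s p = p := fun s hs p hp h1 =>
    h.rel_ends s hs p hp (Or.inr h1)
  have e2 : ∀ s ∈ Set.Icc (0 : ℝ) 1, ∀ p ∈ slab, p.2 = 0 → Φ' s p = p := fun s hs p hp h1 =>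
    h'.rel_ends s hs p hp (Or.inl h1)
  have hfix : ∀ s ∈ Set.Icc (0 : ℝ) 1, ∀ p ∈ slab,
      (∀ q ∈ slab, vert (1 / 2) 0 q = p → Φ s q = q) →
      (∀ q ∈ slab, vert (1 / 2) (1 / 2) q = p → Φ' s q = q) → _root_.stack (Φ s) (Φ' s) p = p := by
    intro s hs p hp h1 h2
    rw [slab_eq_union] at hp
    rcases hp with ⟨p, hp, rfl⟩ | ⟨p, hp, rfl⟩
    · rw [stack_lower hp, h1 p hp rfl]
    · rw [stack_upper (e1 s hs) (e2 s hs) hp, h2 p hp rfl]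
  refine ⟨?_, fun s hs => bijOn_stack (h.bij s hs) (h'.bij s hs) (e1 s hs) (e2 s hs),
    fun p hp => hfix 0 ⟨le_rfl, zero_le_one⟩ p hp (fun q hq _ => h.start q hq)
      fun q hq _ => h'.start q hq, fun s hs p hp hp' => hfix s hs p hp ?_ ?_⟩
  · let f : ℝ → (ℝ × R5) × R5 →ᵃ[ℝ] (ℝ × R5) × R5 := fun b =>
      ((AffineMap.id ℝ ℝ).prodMap (vertAffine (1 / 2) b)).prodMap (vertAffine (1 / 2) b)
    have hf : ∀ b q, f b q = ((q.1.1, vert (1 / 2) b q.1.2), vert (1 / 2) b q.2) := by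
      intro b q
      simp [f, coe_vertAffine]
    convert (h.pl.image (f 0)).union (h'.pl.image (f (1 / 2))) using 1
    ext ⟨⟨s, p⟩, q⟩
    simp only [Set.mem_ofPred_eq, Set.mem_union, Set.mem_image, hf]
    constructor
    · rintro ⟨hs, hp, rfl⟩
      rw [slab_eq_union] at hp
      rcases hp with ⟨p, hp, rfl⟩ | ⟨p, hp, rfl⟩
      · exact Or.inl ⟨((s, p), Φ s p), ⟨hs, hp, rfl⟩, by rw [stack_lower hp]⟩
      · exact Or.inr ⟨((s, p), Φ' s p), ⟨hs, hp, rfl⟩, by rw [stack_upper (e1 s hs) (e2 s hs) hp]⟩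
    · rintro (⟨⟨⟨s', p'⟩, q'⟩, ⟨hs, hp, hq⟩, he⟩ | ⟨⟨⟨s', p'⟩, q'⟩, ⟨hs, hp, hq⟩, he⟩) <;>
        simp only [Prod.mk.injEq] at he hs hp hq <;> obtain ⟨⟨rfl, rfl⟩, rfl⟩ := he <;> subst hq
      · exact ⟨hs, slab_eq_union ▸ Or.inl ⟨p', hp, rfl⟩, (stack_lower hp).symm⟩
      · exact ⟨hs, slab_eq_union ▸ Or.inr ⟨p', hp, rfl⟩,
          (stack_upper (e1 s' hs) (e2 s' hs) hp).symm⟩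
  · rintro q hq rfl
    refine h.rel_ends s hs q hq ?_
    have := hq.2.2
    simp only [vert] at hp'
    rcases hp' with h | h
    exacts [Or.inl (by linarith), Or.inr (by linarith)]
  · rintro q hq rfl
    refine h'.rel_ends s hs q hq ?_
    have := hq.2.1
    simp only [vert] at hp'
    rcases hp' with h | h
    exacts [Or.inl (by linarith), Or.inr (by linarith)]

/-- The composite of two cobordisms. -/
noncomputable def Cobordism.glue {G H I : KauffmanGraph} (A : Cobordism G H) (B : Cobordism H I) :
    Cobordism G I :=
  ⟨A.1.glue B.1, A.2.glue B.2⟩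

theorem Isotopic.glue {G H I : KauffmanGraph} {A A' : Cobordism G H} {B B' : Cobordism H I}
    (hA : Isotopic A A') (hB : Isotopic B B') : Isotopic (A.glue B) (A'.glue B') := by
  have h1 : (1 : ℝ) ∈ Set.Icc (0 : ℝ) 1 := ⟨zero_le_one, le_rfl⟩
  rw [isotopic_iff] at hA hB ⊢
  obtain ⟨Φ, hΦ, hc⟩ := hA
  obtain ⟨Φ', hΦ', hc'⟩ := hB
  refine ⟨_, hΦ.stack hΦ', ?_⟩
  have c1 := hc.conj (F := stack (Φ 1) (Φ' 1)) (by norm_num) (match_glue_lower A.2 B.2)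
    (match_glue_lower A'.2 B'.2) (hΦ.bij 1 h1).mapsTo fun p hp => stack_lower hp
  have c2 := hc'.conj (F := stack (Φ 1) (Φ' 1)) (by norm_num) (match_glue_upper A.2 B.2)
    (match_glue_upper A'.2 B'.2) (hΦ'.bij 1 h1).mapsTo fun p hp => stack_upper
      (fun p hp h => hΦ.rel_ends 1 h1 p hp (Or.inr h))
      (fun p hp h => hΦ'.rel_ends 1 h1 p hp (Or.inl h)) hp
  norm_num at c1 c2
  exact c1.join c2

/-! ### Changes of the height function -/

/-- Piecewise linear functions on the unit square. -/
def IsPLOnSquare (φ : ℝ → ℝ → ℝ) : Prop :=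
  IsPolyhedron {q : (ℝ × ℝ) × ℝ |
    q.1.1 ∈ Set.Icc (0 : ℝ) 1 ∧ q.1.2 ∈ Set.Icc (0 : ℝ) 1 ∧ q.2 = φ q.1.1 q.1.2}

/-- `((s, t), y) ↦ ((s, t), a s + b t + c)`. -/
noncomputable def resetHeight (a b c : ℝ) : (ℝ × ℝ) × ℝ →ᵃ[ℝ] (ℝ × ℝ) × ℝ :=
  AffineMap.prod AffineMap.fst
    ((a • LinearMap.fst ℝ ℝ ℝ + b • LinearMap.snd ℝ ℝ ℝ).toAffineMap.comp AffineMap.fst +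
      AffineMap.const ℝ _ c)

theorem resetHeight_apply (a b c : ℝ) (q : (ℝ × ℝ) × ℝ) :
    resetHeight a b c q = (q.1, a * q.1.1 + b * q.1.2 + c) := by
  simp [resetHeight]

/-- `((s, t), y) ↦ y - a s - b t`. -/
noncomputable def relativeHeight (a b : ℝ) : (ℝ × ℝ) × ℝ →ₗ[ℝ] ℝ :=
  LinearMap.snd ℝ _ _ - (a • LinearMap.fst ℝ ℝ ℝ + b • LinearMap.snd ℝ ℝ ℝ) ∘ₗ LinearMap.fst ℝ _ _

theorem relativeHeight_apply (a b : ℝ) (q : (ℝ × ℝ) × ℝ) :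
    relativeHeight a b q = q.2 - (a * q.1.1 + b * q.1.2) := by
  simp [relativeHeight]

namespace IsPLOnSquare

theorem affine (a b c : ℝ) : IsPLOnSquare fun s t => a * s + b * t + c := by
  have h := isPolyhedron_Icc (zero_le_one (α := ℝ))
  unfold IsPLOnSquare
  convert ((h.prod h).prod h).image (resetHeight a b c) using 1
  ext ⟨⟨s, t⟩, y⟩
  simp only [Set.mem_ofPred_eq, Set.mem_image, Set.mem_prod, resetHeight_apply]
  constructor
  · rintro ⟨hs, ht, rfl⟩
    exact ⟨((s, t), 0), ⟨⟨hs, ht⟩, le_rfl, zero_le_one⟩, rfl⟩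
  · rintro ⟨⟨⟨s', t'⟩, y'⟩, ⟨⟨hs, ht⟩, -⟩, he⟩
    simp only [Prod.mk.injEq] at he hs ht
    obtain ⟨⟨rfl, rfl⟩, rfl⟩ := he
    exact ⟨hs, ht, rfl⟩

/-- The new graph consists of the part of the old one below the affine function, together with the
part above it projected vertically onto the affine graph. -/
theorem min_affine {φ : ℝ → ℝ → ℝ} (h : IsPLOnSquare φ) (a b c : ℝ) :
    IsPLOnSquare fun s t => min (φ s t) (a * s + b * t + c) := by
  unfold IsPLOnSquare
  convert (h.inter_halfSpace (relativeHeight a b) c).union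
    ((h.inter_halfSpace (-relativeHeight a b) (-c)).image (resetHeight a b c)) using 1
  ext ⟨⟨s, t⟩, y⟩
  simp only [Set.mem_ofPred_eq, Set.mem_image, Set.mem_union, Set.mem_inter_iff, resetHeight_apply,
    LinearMap.neg_apply, relativeHeight_apply, neg_le_neg_iff]
  constructor
  · rintro ⟨hs, ht, rfl⟩
    rcases le_total (φ s t) (a * s + b * t + c) with h1 | h1
    · rw [min_eq_left h1]
      exact Or.inl ⟨⟨hs, ht, rfl⟩, by linarith⟩
    · rw [min_eq_right h1]
      exact Or.inr ⟨((s, t), φ s t), ⟨⟨hs, ht, rfl⟩, by simp only; linarith⟩, rfl⟩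
  · rintro (⟨⟨hs, ht, rfl⟩, h1⟩ | ⟨⟨⟨s', t'⟩, y'⟩, ⟨⟨hs, ht, hy⟩, h1⟩, he⟩)
    · exact ⟨hs, ht, (min_eq_left (by linarith)).symm⟩
    · simp only [Prod.mk.injEq] at he hs ht hy h1
      obtain ⟨⟨rfl, rfl⟩, rfl⟩ := he
      exact ⟨hs, ht, (min_eq_right (by linarith)).symm⟩

theorem max_affine {φ : ℝ → ℝ → ℝ} (h : IsPLOnSquare φ) (a b c : ℝ) :
    IsPLOnSquare fun s t => max (φ s t) (a * s + b * t + c) := by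
  unfold IsPLOnSquare
  convert (h.inter_halfSpace (-relativeHeight a b) (-c)).union
    ((h.inter_halfSpace (relativeHeight a b) c).image (resetHeight a b c)) using 1
  ext ⟨⟨s, t⟩, y⟩
  simp only [Set.mem_ofPred_eq, Set.mem_image, Set.mem_union, Set.mem_inter_iff, resetHeight_apply,
    LinearMap.neg_apply, relativeHeight_apply, neg_le_neg_iff]
  constructor
  · rintro ⟨hs, ht, rfl⟩
    rcases le_total (a * s + b * t + c) (φ s t) with h1 | h1
    · rw [max_eq_left h1]
      exact Or.inl ⟨⟨hs, ht, rfl⟩, by linarith⟩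
    · rw [max_eq_right h1]
      exact Or.inr ⟨((s, t), φ s t), ⟨⟨hs, ht, rfl⟩, by simp only; linarith⟩, rfl⟩
  · rintro (⟨⟨hs, ht, rfl⟩, h1⟩ | ⟨⟨⟨s', t'⟩, y'⟩, ⟨⟨hs, ht, hy⟩, h1⟩, he⟩)
    · exact ⟨hs, ht, (max_eq_left (by linarith)).symm⟩
    · simp only [Prod.mk.injEq] at he hs ht hy h1
      obtain ⟨⟨rfl, rfl⟩, rfl⟩ := he
      exact ⟨hs, ht, (max_eq_right (by linarith)).symm⟩

end IsPLOnSquare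

/-- PL isotopies of the unit interval relative to its ends. -/
structure IsReparam (φ : ℝ → ℝ → ℝ) : Prop where
  pl : IsPLOnSquare φ
  strictMono : ∀ s, StrictMono (φ s)
  continuous : ∀ s, Continuous (φ s)
  start : ∀ t ∈ Set.Icc (0 : ℝ) 1, φ 0 t = t
  zero : ∀ s ∈ Set.Icc (0 : ℝ) 1, φ s 0 = 0
  one : ∀ s ∈ Set.Icc (0 : ℝ) 1, φ s 1 = 1

/-- The graph is, up to a linear rearrangement of coordinates, the product of `S3` with the graph of
`φ`. -/
theorem IsReparam.isPLIsotopy {φ : ℝ → ℝ → ℝ} (h : IsReparam φ) :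
    IsPLIsotopy fun s p => (p.1, φ s p.2) where
  pl := by
    let f : R4 × ((ℝ × ℝ) × ℝ) →ₗ[ℝ] (ℝ × R5) × R5 :=
      ((LinearMap.fst ℝ ℝ ℝ ∘ₗ LinearMap.fst ℝ _ _ ∘ₗ LinearMap.snd ℝ _ _).prod
        ((LinearMap.fst ℝ _ _).prod
          (LinearMap.snd ℝ ℝ ℝ ∘ₗ LinearMap.fst ℝ _ _ ∘ₗ LinearMap.snd ℝ _ _))).prod
        ((LinearMap.fst ℝ _ _).prod (LinearMap.snd ℝ _ _ ∘ₗ LinearMap.snd ℝ _ _))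
    have hf : ∀ q, f q = ((q.2.1.1, q.1, q.2.1.2), q.1, q.2.2) := fun q => rfl
    convert (isPolyhedron_S3.prod h.pl).image f.toAffineMap using 1
    ext ⟨⟨s, x, t⟩, x', y⟩
    simp only [Set.mem_ofPred_eq, Set.mem_image, LinearMap.coe_toAffineMap, hf, Prod.mk.injEq]
    constructor
    · rintro ⟨hs, ⟨hx, ht⟩, rfl, rfl⟩
      exact ⟨(x', (s, t), φ s t), ⟨hx, hs, ht, rfl⟩, ⟨rfl, rfl, rfl⟩, rfl, rfl⟩
    · rintro ⟨⟨x, ⟨s, t⟩, y⟩, ⟨hx, hs, ht, hy⟩, ⟨rfl, rfl, rfl⟩, rfl, rfl⟩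
      exact ⟨hs, ⟨hx, ht⟩, rfl, hy⟩
  bij s hs := by
    have hm : ∀ t ∈ Set.Icc (0 : ℝ) 1, φ s t ∈ Set.Icc (0 : ℝ) 1 := by
      intro t ht
      rw [← h.zero s hs, ← h.one s hs]
      exact ⟨(h.strictMono s).monotone ht.1, (h.strictMono s).monotone ht.2⟩
    refine ⟨fun p hp => ⟨hp.1, hm _ hp.2⟩, fun p _ q _ he => ?_, fun p hp => ?_⟩
    · rw [Prod.mk.injEq] at he
      exact Prod.ext he.1 ((h.strictMono s).injective he.2)
    · have := intermediate_value_Icc (zero_le_one (α := ℝ)) (h.continuous s).continuousOn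
      rw [h.zero s hs, h.one s hs] at this
      obtain ⟨t, ht, he⟩ := this hp.2
      exact ⟨(p.1, t), ⟨hp.1, ht⟩, Prod.ext rfl he⟩
  start p hp := Prod.ext rfl (h.start _ hp.2)
  rel_ends s hs p _ h01 := by
    rcases h01 with h0 | h0
    · exact Prod.ext rfl (by simp only [h0, h.zero s hs])
    · exact Prod.ext rfl (by simp only [h0, h.one s hs])

theorem IsReparam.isotopic {φ : ℝ → ℝ → ℝ} (h : IsReparam φ) {G H : KauffmanGraph}
    {A B : Cobordism G H} (hc : Carries (fun p => (p.1, φ 1 p.2)) A.1 B.1 0 1) : Isotopic A B :=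
  isotopic_iff.2 ⟨_, h.isPLIsotopy, hc⟩

open CategoryTheory

/-! ### The laws of the cobordism category -/

/-- The identity cobordism. -/
def Cobordism.cylinder (G : KauffmanGraph) : Cobordism G G :=
  ⟨TwoComplex.cylinder G.toSpatialGraph, isCobordism_cylinder⟩

/-- On the unit interval the term `t - s` dominates at `s = 0`, giving the identity, and is
dominated by `2 t - 1` at `s = 1`, leaving the two-piece map `max (c t) (2 t - 1)`. -/
theorem isReparam_max {c : ℝ} (h0 : 0 < c) (h1 : c < 1) :
    IsReparam fun s t => max (max (0 * s + c * t + 0) (0 * s + 2 * t + -1)) (-1 * s + 1 * t + 0) where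
  pl := ((IsPLOnSquare.affine _ _ _).max_affine _ _ _).max_affine _ _ _
  strictMono s x y h := by
    have := mul_lt_mul_of_pos_left h h0
    refine max_lt_max (max_lt_max ?_ ?_) ?_ <;> linarith
  continuous s := by fun_prop
  start t ht := by
    have := mul_le_mul_of_nonneg_right h1.le ht.1
    rw [max_eq_right (max_le (by linarith) (by linarith [ht.2]))]
    ring
  zero s hs := by
    rw [max_eq_left (a := (0 * s + c * 0 + 0)) (by linarith),
      max_eq_left (by linarith [hs.1])]
    ring
  one s hs := by
    rw [max_eq_right (a := (0 * s + c * 1 + 0)) (by linarith),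
      max_eq_left (by linarith [hs.1])]
    ring

theorem isReparam_min {c : ℝ} (h0 : 0 < c) (h1 : c < 1) :
    IsReparam fun s t =>
      min (min (0 * s + 2 * t + 0) (0 * s + c * t + (1 - c))) (1 * s + 1 * t + 0) where
  pl := ((IsPLOnSquare.affine _ _ _).min_affine _ _ _).min_affine _ _ _
  strictMono s x y h := by
    have := mul_lt_mul_of_pos_left h h0
    refine min_lt_min (min_lt_min ?_ ?_) ?_ <;> linarith
  continuous s := by fun_prop
  start t ht := by
    have := mul_le_mul_of_nonneg_left ht.2 (sub_nonneg.2 h1.le)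
    rw [min_eq_right (le_min (by linarith [ht.1]) (by linarith))]
    ring
  zero s hs := by
    rw [min_eq_left (a := (0 * s + 2 * 0 + 0)) (by linarith),
      min_eq_left (by linarith [hs.1])]
    ring
  one s hs := by
    rw [min_eq_right (a := (0 * s + 2 * 1 + 0)) (by linarith),
      min_eq_left (by linarith [hs.1])]
    ring

/-- At time 1 the three slopes 2, 1, 1/2 change at heights 1/4 and 1/2, which carries the
subdivision 1/4, 1/2 of the left bracketing to 1/2, 3/4. -/
theorem isReparam_assoc :
    IsReparam fun s t => min (min (min (0 * s + 2 * t + 0) (0 * s + 1 * t + 1 / 4))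
      (0 * s + 1 / 2 * t + 1 / 2)) (1 * s + 1 * t + 0) where
  pl := (((IsPLOnSquare.affine _ _ _).min_affine _ _ _).min_affine _ _ _).min_affine _ _ _
  strictMono s x y h := by
    refine min_lt_min (min_lt_min (min_lt_min ?_ ?_) ?_) ?_ <;> linarith
  continuous s := by fun_prop
  start t ht := by
    rw [min_eq_right (le_min (le_min (by linarith [ht.1]) (by linarith)) (by linarith [ht.2]))]
    ring
  zero s hs := by
    rw [min_eq_left (a := 0 * s + 2 * 0 + 0) (by linarith),
      min_eq_left (a := 0 * s + 2 * 0 + 0) (by linarith), min_eq_left (by linarith [hs.1])]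
    ring
  one s hs := by
    rw [min_eq_right (a := (0 * s + 2 * 1 + 0)) (by linarith),
      min_eq_right (a := 0 * s + 1 * 1 + 1 / 4) (by linarith), min_eq_left (by linarith [hs.1])]
    ring

theorem TwoComplex.Match.cast {K L : TwoComplex} {a b a' b' c d : ℝ} (h : Match K L a b c d)
    (ha : a = a') (hb : b = b') : Match K L a' b' c d := by
  subst ha hb; exact h

section GlueHalves

variable {G H I : SpatialGraph} {A B : TwoComplex}

theorem match_glue_lower_symm (hA : A.IsCobordism G H) (hB : B.IsCobordism H I) :
    Match (A.glue B) A 2 0 0 (1 / 2) :=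
  (((match_glue_lower hA hB).symm (by norm_num)).cast (by norm_num) (by norm_num)).mono
    (by norm_num) (by norm_num)

theorem match_glue_upper_symm (hA : A.IsCobordism G H) (hB : B.IsCobordism H I) :
    Match (A.glue B) B 2 (-1) (1 / 2) 1 :=
  (((match_glue_upper hA hB).symm (by norm_num)).cast (by norm_num) (by norm_num)).mono
    (by norm_num) (by norm_num)

end GlueHalves

/-- Up to height `(1 + ε) / 2` the glued complex is a cylinder, consisting of the identity and the
compressed collar of `A`. It is compressed linearly onto the collar `[0, ε]`; the rest is expanded
by `2 t - 1`. -/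
theorem isotopic_cylinder_glue {G H : KauffmanGraph} (A : Cobordism G H) :
    Isotopic ((Cobordism.cylinder G).glue A) A := by
  obtain ⟨ε, h0, h1, hb, -⟩ := A.2.exists_collar
  -- The slope that sends `(1 + ε) / 2` to `ε`, where `2 t - 1` takes the same value.
  set c := 2 * ε / (1 + ε) with hc
  have hcε : c * (1 + ε) = 2 * ε := div_mul_cancel₀ _ (by linarith)
  have hc0 : 0 < c := by positivity
  have hc1 : c < 1 := by rw [hc, div_lt_one (by linarith)]; linarith
  have hcyl := (Cobordism.cylinder G).2
  refine (isReparam_max hc0 hc1).isotopic ?_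
  have m1 := (match_glue_lower_symm hcyl A.2).trans (by norm_num)
    (match_cylinder (a := 1 / 2) (b := 0) (c := 0) (d := 1) (by norm_num) le_rfl le_rfl
      (by norm_num) (by norm_num)) (by norm_num) (by norm_num)
  have m2 := (((match_glue_upper_symm hcyl A.2).mono le_rfl (d' := (1 + ε) / 2)
    (by linarith)).trans (by norm_num) hb (by norm_num) (by linarith)).trans (by norm_num)
    (match_cylinder (a := 1 / 2) (b := 1 / 2) (c := 0) (d := ε) (by norm_num) le_rfl h1.le
      (by norm_num) (by linarith)) (by norm_num) (by linarith)
  have m3 := (m1.cast (a' := 1) (b' := 0) (by norm_num) (by norm_num)).join one_pos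
    (m2.cast (by norm_num) (by norm_num))
  have m4 := (m3.trans zero_le_one (match_cylinder (a := c) (b := 0) (c := 0) (d := (1 + ε) / 2)
    hc0 le_rfl (by linarith) (by linarith) (by linarith)) (by linarith) (by linarith)).trans
    (by linarith) (hb.symm one_pos) (by linarith) (by linarith)
  refine Carries.join (d := (1 + ε) / 2)
    (.of_match (m4.cast (a' := c) (b' := 0) (by ring) (by ring)) fun p hp _ hd => ?_)
    (.of_match ((match_glue_upper_symm hcyl A.2).mono (by linarith) le_rfl) fun p hp hd _ => ?_)
  · refine Prod.ext rfl ?_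
    have e1 := mul_nonneg hc0.le hp.2.1
    have e2 := mul_le_mul_of_nonneg_left hd (sub_nonneg.2 (hc1.le.trans one_le_two))
    simp only [vert]
    rw [max_eq_left (a := 0 * 1 + c * p.2 + 0) (by linarith),
      max_eq_left (by linarith [hp.2.2])]
    ring
  · refine Prod.ext rfl ?_
    have e2 := mul_le_mul_of_nonneg_left hd (sub_nonneg.2 (hc1.le.trans one_le_two))
    simp only [vert]
    rw [max_eq_right (a := 0 * 1 + c * p.2 + 0) (by linarith),
      max_eq_left (by linarith [hp.2.1])]
    ring

theorem isotopic_glue_cylinder {G H : KauffmanGraph} (A : Cobordism G H) :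
    Isotopic (A.glue (Cobordism.cylinder H)) A := by
  obtain ⟨ε, h0, h1, -, ht⟩ := A.2.exists_collar
  -- The same slope, now for the upper collar: `c t + 1 - c` and `2 t` agree at `t = (1 - ε) / 2`,
  -- with value `1 - ε`.
  set c := 2 * ε / (1 + ε) with hc
  have hcε : c * (1 + ε) = 2 * ε := div_mul_cancel₀ _ (by linarith)
  have hc0 : 0 < c := by positivity
  have hc1 : c < 1 := by rw [hc, div_lt_one (by linarith)]; linarith
  have hcyl := (Cobordism.cylinder H).2
  refine (isReparam_min hc0 hc1).isotopic ?_
  have m1 := (((match_glue_lower_symm A.2 hcyl).mono (c' := (1 - ε) / 2) (by linarith)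
    le_rfl).trans (by norm_num) ht (by linarith) (by norm_num)).trans (by norm_num)
    (match_cylinder (a := 1 / 2) (b := 0) (c := 1 - ε) (d := 1) (by norm_num) (by linarith) le_rfl
      (by linarith) (by norm_num)) (by linarith) (by norm_num)
  have m2 := (match_glue_upper_symm A.2 hcyl).trans (by norm_num)
    (match_cylinder (a := 1 / 2) (b := 1 / 2) (c := 0) (d := 1) (by norm_num) le_rfl le_rfl
      (by norm_num) (by norm_num)) (by norm_num) (by norm_num)
  have m3 := (m1.cast (a' := 1) (b' := 0) (by norm_num) (by norm_num)).join one_pos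
    (m2.cast (by norm_num) (by norm_num))
  have m4 := (m3.trans zero_le_one (match_cylinder (a := c) (b := 1 - c) (c := (1 - ε) / 2) (d := 1)
    hc0 (by linarith) le_rfl (by linarith) (by linarith)) (by linarith) (by linarith)).trans
    (by linarith) (ht.symm one_pos) (by linarith) (by linarith)
  refine Carries.join (d := (1 - ε) / 2)
    (.of_match ((match_glue_lower_symm A.2 hcyl).mono le_rfl (by linarith)) fun p hp _ hd => ?_)
    (.of_match (m4.cast (a' := c) (b' := 1 - c) (by ring) (by ring)) fun p hp hd _ => ?_)
  · refine Prod.ext rfl ?_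
    have e2 := mul_le_mul_of_nonneg_left hd (sub_nonneg.2 (hc1.le.trans one_le_two))
    simp only [vert]
    rw [min_eq_left (a := 0 * 1 + 2 * p.2 + 0) (by linarith),
      min_eq_left (by linarith [hp.2.2])]
    ring
  · refine Prod.ext rfl ?_
    have e1 := mul_le_mul_of_nonneg_left hp.2.2 hc0.le
    have e2 := mul_le_mul_of_nonneg_left hd (sub_nonneg.2 (hc1.le.trans one_le_two))
    simp only [vert]
    rw [min_eq_right (a := 0 * 1 + 2 * p.2 + 0) (by linarith),
      min_eq_left (by linarith [hp.2.1])]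
    ring

theorem isotopic_glue_assoc {G H I J : KauffmanGraph} (A : Cobordism G H) (B : Cobordism H I)
    (C : Cobordism I J) : Isotopic ((A.glue B).glue C) (A.glue (B.glue C)) := by
  refine isReparam_assoc.isotopic ?_
  have lo := match_glue_lower_symm (A.glue B).2 C.2
  have m1 := ((lo.mono le_rfl (d' := 1 / 4) (by norm_num)).trans (by norm_num)
    (match_glue_lower_symm A.2 B.2) (by norm_num) (by norm_num)).trans (by norm_num)
    (match_glue_lower A.2 (B.glue C).2) (by norm_num) (by norm_num)
  have m2 := (((lo.mono (c' := 1 / 4) (by norm_num) le_rfl).trans (by norm_num)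
    (match_glue_upper_symm A.2 B.2) (by norm_num) (by norm_num)).trans (by norm_num)
    (match_glue_lower B.2 C.2) (by norm_num) (by norm_num)).trans (by norm_num)
    (match_glue_upper A.2 (B.glue C).2) (by norm_num) (by norm_num)
  have m3 := ((match_glue_upper_symm (A.glue B).2 C.2).trans (by norm_num)
    (match_glue_upper B.2 C.2) (by norm_num) (by norm_num)).trans (by norm_num)
    (match_glue_upper A.2 (B.glue C).2) (by norm_num) (by norm_num)
  refine Carries.join (d := 1 / 4)
    (.of_match (m1.cast (a' := 2) (b' := 0) (by norm_num) (by norm_num)) fun p hp _ h2 => ?_)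
    (Carries.join (d := 1 / 2)
    (.of_match (m2.cast (a' := 1) (b' := 1 / 4) (by norm_num) (by norm_num)) fun p hp h1 h2 => ?_)
    (.of_match (m3.cast (a' := 1 / 2) (b' := 1 / 2) (by norm_num) (by norm_num))
      fun p hp h1 _ => ?_))
  · refine Prod.ext rfl ?_
    simp only [vert]
    rw [min_eq_left (a := 0 * 1 + 2 * p.2 + 0) (by linarith),
      min_eq_left (a := 0 * 1 + 2 * p.2 + 0) (by linarith), min_eq_left (by linarith)]
    ring
  · refine Prod.ext rfl ?_
    simp only [vert]
    rw [min_eq_right (a := 0 * 1 + 2 * p.2 + 0) (by linarith),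
      min_eq_left (a := 0 * 1 + 1 * p.2 + 1 / 4) (by linarith), min_eq_left (by linarith)]
    ring
  · refine Prod.ext rfl ?_
    simp only [vert]
    rw [min_eq_right (a := 0 * 1 + 2 * p.2 + 0) (by linarith),
      min_eq_right (a := 0 * 1 + 1 * p.2 + 1 / 4) (by linarith), min_eq_left (by linarith)]
    ring

/-- The category of isotopy classes of cobordisms. -/
noncomputable instance cobordismCategory : Category.{0} KauffmanGraph where
  Hom := CobordismClass
  id G := Quot.mk _ (Cobordism.cylinder G)
  -- The quotient is by the generated equivalence, so neither symmetry nor transitivity of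
  -- `Isotopic` has to be proved; reflexivity suffices to vary one factor at a time.
  comp := Quot.map₂ Cobordism.glue (fun A _ _ h => (isotopic_refl A).glue h)
    fun _ _ B h => h.glue (isotopic_refl B)
  id_comp := by rintro _ _ ⟨A⟩; exact Quot.sound (isotopic_cylinder_glue A)
  comp_id := by rintro _ _ ⟨A⟩; exact Quot.sound (isotopic_glue_cylinder A)
  assoc := by rintro _ _ _ _ ⟨A⟩ ⟨B⟩ ⟨C⟩; exact Quot.sound (isotopic_glue_assoc A B C)

/-! ### The preadditive category -/

theorem mainTheorem5 :
    ∃ (cylinder_cob : ∀ G : KauffmanGraph,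
        (TwoComplex.cylinder G.toSpatialGraph).IsCobordism G.toSpatialGraph G.toSpatialGraph)
      (glue_cob : ∀ (G H K : KauffmanGraph) (A B : TwoComplex),
        A.IsCobordism G.toSpatialGraph H.toSpatialGraph →
        B.IsCobordism H.toSpatialGraph K.toSpatialGraph →
        (A.glue B).IsCobordism G.toSpatialGraph K.toSpatialGraph)
      (cat : CategoryTheory.Category.{0} KauffmanGraph)
      (_pre : CategoryTheory.Preadditive KauffmanGraph)
      (e : ∀ G H : KauffmanGraph, cat.Hom G H ≃+ CobordismGroup G H),
      (∀ G : KauffmanGraph, e G G (cat.id G) = cobordismClass _ (cylinder_cob G)) ∧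
      ∀ (G H K : KauffmanGraph) (A B : TwoComplex)
        (hA : A.IsCobordism G.toSpatialGraph H.toSpatialGraph)
        (hB : B.IsCobordism H.toSpatialGraph K.toSpatialGraph),
        e G K (cat.comp ((e G H).symm (cobordismClass A hA))
            ((e H K).symm (cobordismClass B hB))) =
          cobordismClass (A.glue B) (glue_cob G H K A B hA hB) := by
  refine ⟨fun G => isCobordism_cylinder, fun G H K A B hA hB => hA.glue hB,
    -- Morphisms of the free ℤ-linear category are by definition finitely supported integer
    -- functions on isotopy classes, so the identification of the Hom-groups is the identity, and
    -- composition of basis elements reduces to multiplying the coefficients 1 and 1.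
    categoryFree ℤ KauffmanGraph, Free.instPreadditive ℤ KauffmanGraph,
    fun G H => AddEquiv.refl (CobordismGroup G H), fun G => rfl, fun G H K A B hA hB => ?_⟩
  refine (Free.single_comp_single ℤ KauffmanGraph (X := G) (Y := H) (Z := K) (Quot.mk _ ⟨A, hA⟩)
    (Quot.mk _ ⟨B, hB⟩) 1 1).trans ?_
  rw [one_mul]
  rfl
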